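/- **Proposition 2.27.** Let $a,b\in\mathbb R^*$ with $a\neq b$, not both negative. For $\lambda\in\mathbb C\setminus\{a,b\}$ let $\mathcal C_\lambda\subset\mathbb{CP}^2$ be the conic $$\mathcal C_\lambda:\ \frac{x^2}{a-\lambda}+\frac{y^2}{b-\lambda}=z^2,$$ and let $\mathcal C=\mathcal C_0$, a complexified ellipse ($a,b>0$) or hyperbola ($ab<0$); the $\mathcal C_\lambda$ are the conics confocal to $\mathcal C$. *Definitions.* The symmetry about a line $L$ containing neither $I=(1:i:0)$ nor $J=(1:-i:0)$ (a non-isotropic line) is the unique non-trivial involution of $\mathbb C^2=\{z=1\}$ that is isometric for $dx^2+dy^2$ and fixes the points of $L$; it acts on lines and fixes the line at infinity. Symmetry, with respect to an isotropic line $L$, of lines through a finite point of $L$ is defined by limits of triples of lines (mirror non-isotropic, two lines symmetric about it) through points converging to that point. Lines are reflected at $p\in\mathcal C$ by the symmetry with respect to the tangent line $T_p\mathcal C$. A conic $D$ is a complex caustic of $\mathcal C$ if every line tangent to $D$ is reflected, at any point where it meets $\mathcal C$, into a line tangent to $D$. A non-degenerate $n$-periodic orbit is a cyclic sequence $p_1,\dots,p_n\in\mathcal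 C$ with $p_j\ne p_{j+1}$, with $T_{p_j}\mathcal C$ non-isotropic, and with $p_{j-1}p_j$, $p_jp_{j+1}$ symmetric about $T_{p_j}\mathcal C$. It is circumscribed about $D$ if the $p_j$ are distinct and, for every $j$, the lines through $p_j$ tangent to $D$ are exactly $p_{j-1}p_j$ and $p_jp_{j+1}$. A conic $D$ is an $n$-caustic of $\mathcal C$ if $D\cap\mathcal C$ consists of four distinct points, $D$ is a complex caustic of $\mathcal C$, and some non-degenerate $n$-periodic orbit of $\mathcal C$ is circumscribed about $D$. *Statement.* Let $$\lambda_\pm=-\frac{ab}{(a-b)^2}\left(a+b\pm2\sqrt{a^2-ab+b^2}\right)\in\mathbb R .$$ 1. $\lambda_+\ne\lambda_-$, and these are exactly the roots (both simple) of the polynomial $\mathcal B^3_{a,b}(\lambda)$, the coefficient of $t^2$ in the Taylor expansion at $t=0$ of $\sqrt{\left(1+\tfrac{a-\lambda}{a}t\right)\left(1+\tfrac{b-\lambda}{b}t\right)(1+t)}$. 2. For $\lambda\in\mathbb C\setminus\{a,b\}$, the conic $\mathcal C_\lambda$ is a $3$-caustic of $\mathcal C$ if and only if $\lambda\in\{\lambda_+,\lambda_-\}$.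 Hence $\mathcal C$ has exactly two confocal $3$-caustics, $\mathcal C_{\lambda_+}\neq\mathcal C_{\lambda_-}$. 3. If $a,b>0$, then $$a-\lambda_+>a>a-\lambda_->0\quad\text{and}\quad b-\lambda_+>b>b-\lambda_->0 .$$ The real parts (sets of finite real points) of $\mathcal C$, $\mathcal C_{\lambda_+}$ and $\mathcal C_{\lambda_-}$ are ellipses; that of $\mathcal C_{\lambda_-}$ lies inside that of $\mathcal C$, which lies inside that of $\mathcal C_{\lambda_+}$. 4. If $ab<0$, then the real parts of $\mathcal C$, $\mathcal C_{\lambda_+}$ and $\mathcal C_{\lambda_-}$ are hyperbolas. If $a>0>b$, then moreover $$a-\lambda_->a>a-\lambda_+>0\quad\text{and}\quad 0>b-\lambda_->b>b-\lambda_+ ,$$ and each branch ($x>0$, respectively $x<0$) of the real part of $\mathcal C$ lies in the domain delimited by the corresponding branches of the real parts of $\mathcal C_{\lambda_+}$ and $\mathcal C_{\lambda_-}$. -/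

import Mathlib

open scoped LinearAlgebra.Projectivization

noncomputable section

namespace ComplexBilliard

/-! ### The complex projective plane -/

/-- The complex projective plane. A point with homogeneous coordinates `(x : y : z)` is the class of
`![x, y, z]`. -/
abbrev CP2 : Type := ℙ ℂ (Fin 3 → ℂ)

/-- Lines of the complex projective plane, in dual homogeneous coordinates: the class of
`![α, β, γ]` is the line `α x + β y + γ z = 0`. -/
abbrev Line : Type := ℙ ℂ (Fin 3 → ℂ)

/-- The usual topology of the projective plane (and of its dual plane, the space of lines): the
quotient topology from `ℂ³ ∖ {0}`. -/
instance : TopologicalSpace CP2 :=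
  TopologicalSpace.coinduced (Projectivization.mk' ℂ) inferInstance

/-- The line `ℓ` contains the point `p`. -/
def Line.Contains (ℓ : Line) (p : CP2) : Prop := Projectivization.orthogonal ℓ p

/-- The line through two distinct points `p` and `q` (used only for `p ≠ q`). -/
def lineThrough (p q : CP2) : Line := by
  classical exact Projectivization.cross p q

/-- A point is finite if it is not on the line at infinity `z = 0`. -/
def IsFinite (p : CP2) : Prop := p.rep 2 ≠ 0

/-- The circular point `I = (1 : i : 0)`. -/
def pointI : CP2 :=
  Projectivization.mk ℂ ![1, Complex.I, 0] (fun h => one_ne_zero (congrFun h 0))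

/-- The circular point `J = (1 : -i : 0)`. -/
def pointJ : CP2 :=
  Projectivization.mk ℂ ![1, -Complex.I, 0] (fun h => one_ne_zero (congrFun h 0))

/-- A line is isotropic if it contains one of the circular points. -/
def Line.IsIsotropic (ℓ : Line) : Prop := ℓ.Contains pointI ∨ ℓ.Contains pointJ

/-! ### The complex reflection law -/

/-- `σ` is the symmetry about the non-isotropic line `L`, written in homogeneous coordinates: it maps
the affine chart `z = 1`, that is `ℂ²`, to itself, and it is there a non-trivial involution that is
isometric for the quadratic form `dx² + dy²` and fixes every point of `L`. -/
structure IsSymmetryAbout (L : Line) (σ : (Fin 3 → ℂ) →ₗ[ℂ] (Fin 3 → ℂ)) : Prop where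
  affine : ∀ v, σ v 2 = v 2
  isometric : ∀ v w, v 2 = 1 → w 2 = 1 →
    (σ v 0 - σ w 0) ^ 2 + (σ v 1 - σ w 1) ^ 2 = (v 0 - w 0) ^ 2 + (v 1 - w 1) ^ 2
  involutive : ∀ v, σ (σ v) = v
  nontrivial : σ ≠ LinearMap.id
  fixes : ∀ v, L.rep ⬝ᵥ v = 0 → σ v = v

/-- A line `α x + β y + γ z = 0` is isotropic if and only if `α² + β² = 0`. -/
theorem Line.isIsotropic_iff (L : Line) : L.IsIsotropic ↔ L.rep 0 ^ 2 + L.rep 1 ^ 2 = 0 := by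
  have key : ∀ (v : Fin 3 → ℂ) (hv : v ≠ 0),
      L.Contains (Projectivization.mk ℂ v hv) ↔ L.rep ⬝ᵥ v = 0 := by
    intro v hv
    conv_lhs => rw [← Projectivization.mk_rep L]
    exact Projectivization.orthogonal_mk _ _
  have hf : L.rep 0 ^ 2 + L.rep 1 ^ 2 =
      (L.rep 0 + L.rep 1 * Complex.I) * (L.rep 0 - L.rep 1 * Complex.I) := by
    linear_combination (L.rep 1 ^ 2) * Complex.I_sq
  rw [hf, mul_eq_zero]
  unfold Line.IsIsotropic pointI pointJ
  rw [key, key]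
  simp [dotProduct, Fin.sum_univ_three, sub_eq_add_neg]

/-- There is exactly one symmetry about a non-isotropic line, the orthogonal reflection. -/
theorem isSymmetryAbout_iff {L : Line} (hL : ¬ L.IsIsotropic)
    (σ : (Fin 3 → ℂ) →ₗ[ℂ] (Fin 3 → ℂ)) :
    IsSymmetryAbout L σ ↔ ∀ v, σ v = v - (2 * (L.rep ⬝ᵥ v) / (L.rep 0 ^ 2 + L.rep 1 ^ 2)) •
      ![L.rep 0, L.rep 1, 0] := by
  rw [Line.isIsotropic_iff] at hL
  set n := L.rep with hn
  set N := n 0 ^ 2 + n 1 ^ 2 with hN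
  have hnN : n ⬝ᵥ ![n 0, n 1, 0] = N := by
    simp [dotProduct, Fin.sum_univ_three, hN]; ring
  constructor
  · rintro ⟨haff, hiso, hinv, hnon, hfix⟩
    -- the image of the normal direction
    set e : Fin 3 → ℂ := ![n 0, n 1, 0] with he
    have hdec : ∀ v, σ v = v + (n ⬝ᵥ v / N) • (σ e - e) := by
      intro v
      have h := hfix (v - (n ⬝ᵥ v / N) • e) (by
        rw [dotProduct_sub, dotProduct_smul, hnN, smul_eq_mul]; field_simp; ring)
      rw [map_sub, map_smul] at h
      rw [smul_sub]
      linear_combination h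
    set w := σ e - e with hw
    have hw2 : w 2 = 0 := by simp [hw, haff]
    have hσw : σ w = -w := by rw [hw, map_sub, hinv]; abel
    have hw0 : w ≠ 0 := by
      intro h0
      refine hnon (LinearMap.ext fun v => ?_)
      rw [hdec, h0, smul_zero, add_zero, LinearMap.id_apply]
    have hnw : n ⬝ᵥ w = -2 * N := by
      have h := hdec w
      rw [hσw] at h
      have h2 : ((2 : ℂ) + n ⬝ᵥ w / N) • w = 0 := by
        rw [add_smul, two_smul]; linear_combination -h
      rcases smul_eq_zero.mp h2 with h3 | h3
      · field_simp at h3; linear_combination h3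
      · exact absurd h3 hw0
    have hdiff : ∀ u : Fin 3 → ℂ, u 2 = 0 →
        (σ u 0) ^ 2 + (σ u 1) ^ 2 = u 0 ^ 2 + u 1 ^ 2 := by
      intro u hu
      have h := hiso (u + ![0, 0, 1]) ![0, 0, 1] (by simp [hu]) (by simp)
      simpa only [map_add, Pi.add_apply, add_sub_cancel_right] using h
    have h1 := hdiff e (by simp [he])
    have h2 := hdiff (e + ![-n 1, n 0, 0]) (by simp [he])
    have hu : σ ![-n 1, n 0, 0] = ![-n 1, n 0, 0] := hfix _ (by
      simp [dotProduct, Fin.sum_univ_three]; ring)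
    have hσe : σ e = e + w := by rw [hw]; abel
    rw [map_add, hu] at h2
    rw [hσe] at h1 h2
    simp only [he, Pi.add_apply, Matrix.cons_val_zero, Matrix.cons_val_one] at h1 h2
    simp [dotProduct, Fin.sum_univ_three, hw2] at hnw
    have horth : n 0 * w 1 - n 1 * w 0 = 0 := by linear_combination (h2 - h1) / 2
    have e0 : w 0 = -2 * n 0 := by
      apply mul_left_cancel₀ hL
      linear_combination n 0 * hnw - n 1 * horth
    have e1 : w 1 = -2 * n 1 := by
      apply mul_left_cancel₀ hL
      linear_combination n 1 * hnw + n 0 * horth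
    have hwe : w = (-2 : ℂ) • e := by
      funext i; fin_cases i <;> simp [e0, e1, hw2, he]
    intro v
    rw [hdec, hwe, smul_smul, sub_eq_add_neg, ← neg_smul]
    congr 2; ring
  · intro h
    have hfix : ∀ v, n ⬝ᵥ v = 0 → σ v = v := by
      intro v hv; rw [h, hv]; simp
    refine ⟨fun v => by simp [h], fun v w hv hw => ?_, fun v => ?_, fun hid => ?_, hfix⟩
    · have hs : n ⬝ᵥ v - n ⬝ᵥ w = n 0 * (v 0 - w 0) + n 1 * (v 1 - w 1) := by
        simp [dotProduct, Fin.sum_univ_three, hv, hw]; ring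
      rw [h, h]
      simp
      field_simp
      rw [hN] at *
      generalize n ⬝ᵥ v = A at *
      generalize n ⬝ᵥ w = B at *
      obtain rfl : A = B + (n 0 * (v 0 - w 0) + n 1 * (v 1 - w 1)) := by linear_combination hs
      ring
    · rw [h (σ v), h v, dotProduct_sub, dotProduct_smul, hnN, smul_eq_mul, sub_sub, ← add_smul]
      have : 2 * (n ⬝ᵥ v) / N + 2 * (n ⬝ᵥ v - 2 * (n ⬝ᵥ v) / N * N) / N = 0 := by
        field_simp; ring
      rw [this]; simp
    · have h1 := h ![n 0, n 1, 0]
      rw [hid, hnN] at h1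
      have h2 : ![n 0, n 1, 0] = (0 : Fin 3 → ℂ) := by
        rw [mul_div_assoc, div_self hL] at h1
        have := sub_eq_self.mp h1.symm
        simpa using this
      rw [h2] at hnN
      simp at hnN
      exact hL hnN.symm

/-- The lines `ℓ` and `ℓ'` are exchanged by the symmetry about the (non-isotropic) line `L`. In
particular the line at infinity is symmetric to itself. -/
def SymmetricLines (L ℓ ℓ' : Line) : Prop :=
  ∃ σ, IsSymmetryAbout L σ ∧ ∀ v, ℓ.rep ⬝ᵥ v = 0 ↔ ℓ'.rep ⬝ᵥ σ v = 0

/-- The complex reflection law at a point `p` of a line `L`: the lines `ℓ` and `ℓ'` through `p` are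
symmetric with respect to `L`. If `L` is isotropic, the point `p` has to be finite and the symmetry is
defined by passing to the limit from non-isotropic lines. -/
def ReflectedAt (p : CP2) (L ℓ ℓ' : Line) : Prop :=
  L.Contains p ∧ ℓ.Contains p ∧ ℓ'.Contains p ∧
    (¬ L.IsIsotropic → SymmetricLines L ℓ ℓ') ∧
    (L.IsIsotropic → IsFinite p ∧
      ∃ (P : ℕ → CP2) (M m m' : ℕ → Line),
        (∀ n, (M n).Contains (P n) ∧ (m n).Contains (P n) ∧ (m' n).Contains (P n) ∧
          ¬ (M n).IsIsotropic ∧ SymmetricLines (M n) (m n) (m' n)) ∧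
        Filter.Tendsto P Filter.atTop (nhds p) ∧
        Filter.Tendsto M Filter.atTop (nhds L) ∧
        Filter.Tendsto m Filter.atTop (nhds ℓ) ∧
        Filter.Tendsto m' Filter.atTop (nhds ℓ'))

/-! ### Conics, caustics and periodic orbits

A conic is given by a quadratic form on `ℂ³`. -/

/-- The set of points of a conic. -/
def locus (Q : QuadraticForm ℂ (Fin 3 → ℂ)) : Set CP2 := {p | Q p.rep = 0}

/-- `ℓ` is the tangent line of the conic `Q` at its point `p`: `ℓ` is the kernel of the non-zero
linear form `v ↦ Q(p + v) - Q(p) - Q(v)`. -/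
def IsTangentAt (Q : QuadraticForm ℂ (Fin 3 → ℂ)) (p : CP2) (ℓ : Line) : Prop :=
  p ∈ locus Q ∧ ∀ v, ℓ.rep ⬝ᵥ v = 0 ↔ QuadraticMap.polar Q p.rep v = 0

/-- `ℓ` is tangent to the conic `Q`. -/
def IsTangent (Q : QuadraticForm ℂ (Fin 3 → ℂ)) (ℓ : Line) : Prop := ∃ p, IsTangentAt Q p ℓ

/-- The conic `D` is a complex caustic of the conic `C`: any line tangent to `D` is reflected, at any
point `p` where it meets `C`, into a line tangent to `D`. -/
def IsComplexCaustic (C D : QuadraticForm ℂ (Fin 3 → ℂ)) : Prop :=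
  ∀ (ℓ : Line) (p : CP2), IsTangent D ℓ → ℓ.Contains p → p ∈ locus C →
    ∃ L ℓ' : Line, IsTangentAt C p L ∧ ReflectedAt p L ℓ ℓ' ∧ IsTangent D ℓ'

/-- `p` is a non-degenerate `n`-periodic orbit of the complex billiard on `C` (vertices are indexed
cyclically). -/
structure IsPeriodicOrbit (C : QuadraticForm ℂ (Fin 3 → ℂ)) (n : ℕ) (p : ZMod n → CP2) : Prop where
  mem : ∀ j, p j ∈ locus C
  consecutive_ne : ∀ j, p j ≠ p (j + 1)
  tangent_not_isotropic : ∀ j L, IsTangentAt C (p j) L → ¬ L.IsIsotropic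
  reflected : ∀ j, ∃ L, IsTangentAt C (p j) L ∧
    ReflectedAt (p j) L (lineThrough (p (j - 1)) (p j)) (lineThrough (p j) (p (j + 1)))

/-- `p` is an `n`-sided polygon (it has distinct vertices) circumscribed about `D`: the lines through
the vertex `p j` that are tangent to `D` are exactly the two sides that meet there. -/
def IsCircumscribedPolygon (D : QuadraticForm ℂ (Fin 3 → ℂ)) (n : ℕ) (p : ZMod n → CP2) : Prop :=
  Function.Injective p ∧
    ∀ j (ℓ : Line), (IsTangent D ℓ ∧ ℓ.Contains (p j)) ↔
      (ℓ = lineThrough (p (j - 1)) (p j) ∨ ℓ = lineThrough (p j) (p (j + 1)))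

/-- Two conics are in general position if they meet in exactly four distinct points. -/
def InGeneralPosition (C D : QuadraticForm ℂ (Fin 3 → ℂ)) : Prop :=
  (locus C ∩ locus D).ncard = 4

/-- `D` is an `n`-caustic of `C`. -/
def IsNCaustic (n : ℕ) (C D : QuadraticForm ℂ (Fin 3 → ℂ)) : Prop :=
  InGeneralPosition C D ∧ IsComplexCaustic C D ∧
    ∃ p : ZMod n → CP2, IsPeriodicOrbit C n p ∧ IsCircumscribedPolygon D n p

/-- The conic `x² / (a - μ) + y² / (b - μ) = z²`, for `μ ≠ a, b`. For `μ = 0` this is the conic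
`x² / a + y² / b = z²`, and the others are the conics confocal to it. -/
def confocal (a b : ℝ) (μ : ℂ) : QuadraticForm ℂ (Fin 3 → ℂ) :=
  QuadraticMap.weightedSumSquares ℂ ![1 / ((a : ℂ) - μ), 1 / ((b : ℂ) - μ), -1]

/-! ### The determinant of Cayley for triangles -/

/-- The coefficient of `t ^ k` in the Taylor expansion of `√(1 + t)` at `0`. -/
def sqrtCoeff (k : ℕ) : ℂ :=
  (-1) ^ (k + 1) / (4 ^ k * (2 * (k : ℂ) - 1)) * (Nat.centralBinom k : ℂ)

/-- The coefficient of `t ^ k` in the Taylor expansion at `0` of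
`√((1 + (a - X) / a * t) (1 + (b - X) / b * t) (1 + t))`, as a polynomial in `X`. -/
def cayleyCoeff (a b : ℝ) (k : ℕ) : Polynomial ℂ :=
  ∑ s ∈ Finset.HasAntidiagonal.antidiagonal k, ∑ r ∈ Finset.HasAntidiagonal.antidiagonal s.1,
    Polynomial.C (sqrtCoeff r.1 * sqrtCoeff r.2 * sqrtCoeff s.2 / ((a : ℂ) ^ r.1 * (b : ℂ) ^ r.2)) *
      (Polynomial.C (a : ℂ) - Polynomial.X) ^ r.1 * (Polynomial.C (b : ℂ) - Polynomial.X) ^ r.2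

/-! ### Real parts -/

/-- The Euclidean plane. -/
abbrev Plane : Type := EuclideanSpace ℝ (Fin 2)

/-- The real part of a conic: the set of its finite points with real coordinates. -/
def realLocus (Q : QuadraticForm ℂ (Fin 3 → ℂ)) : Set Plane :=
  {P | Q ![(P 0 : ℂ), (P 1 : ℂ), 1] = 0}

/-- Ellipses of the Euclidean plane (circles included). -/
def IsEllipse (S : Set Plane) : Prop :=
  ∃ (e : Plane ≃ᵢ Plane) (A B : ℝ), 0 < A ∧ 0 < B ∧ S = {P | e P 0 ^ 2 / A + e P 1 ^ 2 / B = 1}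

/-- Hyperbolas of the Euclidean plane. -/
def IsHyperbola (S : Set Plane) : Prop :=
  ∃ (e : Plane ≃ᵢ Plane) (A B : ℝ), 0 < A ∧ 0 < B ∧ S = {P | e P 0 ^ 2 / A - e P 1 ^ 2 / B = 1}

/-- The open domain of the plane bounded by the ellipse `x² / A + y² / B = 1`, where `A, B > 0`. -/
def ellipseInterior (A B : ℝ) : Set Plane := {P | P 0 ^ 2 / A + P 1 ^ 2 / B < 1}

/-- The branch in the half-plane `x > 0` of a hyperbola that does not meet the axis `x = 0`. -/
def rightBranch (S : Set Plane) : Set Plane := {P | P ∈ S ∧ 0 < P 0}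

/-- The branch in the half-plane `x < 0` of a hyperbola that does not meet the axis `x = 0`. -/
def leftBranch (S : Set Plane) : Set Plane := {P | P ∈ S ∧ P 0 < 0}

/-- The domain of the plane delimited by two curves `S` (on the left) and `T` (on the right), each a
graph of `x` over `y`: the points strictly between them in the `x`-direction. -/
def between (S T : Set Plane) : Set Plane :=
  {P | ∃ s ∈ S, ∃ t ∈ T, s 1 = P 1 ∧ t 1 = P 1 ∧ s 0 < P 0 ∧ P 0 < t 0}

/-! ### The two parameters -/

/-- `λ₊ = - a b (a + b + 2 √(a² - a b + b²)) / (a - b)²`. -/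
def lambdaPlus (a b : ℝ) : ℝ :=
  -(a * b / (a - b) ^ 2) * (a + b + 2 * Real.sqrt (a ^ 2 - a * b + b ^ 2))

/-- `λ₋ = - a b (a + b - 2 √(a² - a b + b²)) / (a - b)²`. -/
def lambdaMinus (a b : ℝ) : ℝ :=
  -(a * b / (a - b) ^ 2) * (a + b - 2 * Real.sqrt (a ^ 2 - a * b + b ^ 2))

end ComplexBilliard

end

open ComplexBilliard

/-!
A line `α x + β y + γ z = 0` is tangent to `confocal a b μ` if and only if
`(a - μ) α² + (b - μ) β² = γ²` (`isTangent_confocal`): the dual conics of a confocal family form a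
pencil, spanned by the dual of `C = confocal a b 0` and the pair of circular points `α² + β² = 0`. Let
`N` be the tangent covector of `C` at a point `p`. Reflection about `N` preserves `α² + β²`, and it
preserves the dual form of `C` on the lines through `p`, because `N` is a zero of that form and is
conjugate to all these lines. Hence it preserves tangency to each member of the pencil. If `N` is
isotropic, it is tangent to all members of the pencil, and any line through `p` may be reflected into
`N` itself (`reflectedAt_isotropic`). So confocal conics are complex caustics of `C`, and the condition
for being a `3`-caustic is the existence of a circumscribed triangular orbit.

In the basis given by the vertices of a triangle inscribed in `C` and circumscribed about `D`, the
matrix of `C` has zero diagonal, and so has the matrix of the dual of `D` in the dual basis, which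
consists of the sides. For the product `M` of two such symmetric `3 × 3` matrices `2 tr M² = (tr M)²`.
Here `M` has the eigenvalues `k = (a - μ) / a`, `l = (b - μ) / b` and `1`, and the identity becomes
Cayley's condition `2 (k² + l² + 1) = (k + l + 1)²`, a quadratic equation in `μ` with the roots `λ₊`
and `λ₋`. This gives necessity (`cayley_of_circumscribed`). Conversely the condition says that
`k = X²` and `l = (1 + X)²` for some `X`, and then the isosceles triangle with the vertices `(√a, 0)`
and `(√a X, ± √(b (1 - X²)))` is a circumscribed orbit (`exists_triangular_orbit`).

The statements on real parts follow from `λ₊ (2 r - a - b) = -3 a b` and `λ₋ (2 r + a + b) = 3 a b`,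
where `r = √(a² - a b + b²)`, because `2 r` exceeds `|a + b|`, `|2 a - b|` and `|2 b - a|`.
-/

namespace ComplexBilliard

open Projectivization Matrix

/-! ### Homogeneous coordinates -/

theorem contains_mk {n p : Fin 3 → ℂ} (hn : n ≠ 0) (hp : p ≠ 0) :
    Line.Contains (mk ℂ n hn) (mk ℂ p hp) ↔ n ⬝ᵥ p = 0 :=
  orthogonal_mk hn hp

theorem rep_dot {n : Fin 3 → ℂ} (hn : n ≠ 0) (v : Fin 3 → ℂ) :
    (mk ℂ n hn).rep ⬝ᵥ v = 0 ↔ n ⬝ᵥ v = 0 := by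
  obtain ⟨c, hc⟩ := exists_smul_eq_mk_rep ℂ n hn
  rw [← hc, smul_dotProduct, smul_eq_zero_iff_eq]

theorem isIsotropic_mk {n : Fin 3 → ℂ} (hn : n ≠ 0) :
    Line.IsIsotropic (mk ℂ n hn) ↔ n 0 ^ 2 + n 1 ^ 2 = 0 := by
  obtain ⟨c, hc⟩ := exists_smul_eq_mk_rep ℂ n hn
  have h : ((c : ℂ) * n 0) ^ 2 + ((c : ℂ) * n 1) ^ 2 = (c : ℂ) ^ 2 * (n 0 ^ 2 + n 1 ^ 2) := by ring
  rw [Line.isIsotropic_iff, ← hc]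
  simp only [Pi.smul_apply, Units.smul_def, smul_eq_mul]
  rw [h]
  simp

theorem mk_mem_locus {Q : QuadraticForm ℂ (Fin 3 → ℂ)} {p : Fin 3 → ℂ} (hp : p ≠ 0) :
    mk ℂ p hp ∈ locus Q ↔ Q p = 0 := by
  obtain ⟨c, hc⟩ := exists_smul_eq_mk_rep ℂ p hp
  change Q (mk ℂ p hp).rep = 0 ↔ _
  rw [← hc, Units.smul_def, QuadraticMap.map_smul]
  simp

theorem isFinite_mk {p : Fin 3 → ℂ} (hp : p ≠ 0) : IsFinite (mk ℂ p hp) ↔ p 2 ≠ 0 := by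
  obtain ⟨c, hc⟩ := exists_smul_eq_mk_rep ℂ p hp
  unfold IsFinite
  rw [← hc, Units.smul_def]
  simp

theorem lineThrough_mk {p q : Fin 3 → ℂ} (hp : p ≠ 0) (hq : q ≠ 0) (h : p ⨯₃ q ≠ 0) :
    lineThrough (mk ℂ p hp) (mk ℂ q hq) = mk ℂ (p ⨯₃ q) h := by
  classical
  exact cross_mk_of_cross_ne_zero hp hq h

/-- A vector orthogonal to `p` and `q` is parallel to `p ⨯₃ q`. -/
theorem cross_cross_eq_zero {x p q : Fin 3 → ℂ} (hp : x ⬝ᵥ p = 0) (hq : x ⬝ᵥ q = 0) :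
    x ⨯₃ (p ⨯₃ q) = 0 := by
  rw [cross_cross_eq_smul_sub_smul', hq, dotProduct_comm p x, hp, zero_smul, zero_smul, sub_zero]

theorem parallel_of_cross_eq_zero {x n : Fin 3 → ℂ} (hn : n ≠ 0) (h : x ⨯₃ n = 0) :
    ∃ c : ℂ, x = c • n := by
  by_cases hx : x = 0
  · exact ⟨0, by simp [hx]⟩
  obtain ⟨c, hc⟩ := (mk_eq_mk_iff' ℂ x n hx hn).1 ((mk_eq_mk_iff_crossProduct_eq_zero hx hn).2 h)
  exact ⟨c, hc.symm⟩

/-- The covector of a line is determined, up to a factor, by the points of the line. -/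
theorem cross_eq_zero_of_ker_le {n m : Fin 3 → ℂ} (h : ∀ v, n ⬝ᵥ v = 0 → m ⬝ᵥ v = 0) :
    n ⨯₃ m = 0 := by
  rw [← dotProduct_eq_zero_iff]
  intro v
  have h1 := h (n ⨯₃ v) (dot_self_cross n v)
  rwa [triple_product_permutation, triple_product_permutation, ← cross_anticomm n m,
    dotProduct_neg, neg_eq_zero, dotProduct_comm] at h1

/-! ### Tangent lines of a diagonal conic -/

theorem weightedSumSquares_eq (w p : Fin 3 → ℂ) :
    QuadraticMap.weightedSumSquares ℂ w p = (w * p) ⬝ᵥ p := by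
  simp [QuadraticMap.weightedSumSquares_apply, dotProduct, Fin.sum_univ_three]
  ring

theorem polar_weightedSumSquares (w p v : Fin 3 → ℂ) :
    QuadraticMap.polar (QuadraticMap.weightedSumSquares ℂ w) p v = 2 * ((w * p) ⬝ᵥ v) := by
  simp [QuadraticMap.polar, dotProduct, Fin.sum_univ_three]
  ring

theorem mul_ne_zero_of_forall {w p : Fin 3 → ℂ} (hw : ∀ i, w i ≠ 0) (hp : p ≠ 0) : w * p ≠ 0 := by
  contrapose! hp
  funext i
  simpa [hw i] using congrFun hp i

theorem isTangentAt_iff {w : Fin 3 → ℂ} (hw : ∀ i, w i ≠ 0) {p : Fin 3 → ℂ} (hp : p ≠ 0)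
    (L : Line) : IsTangentAt (QuadraticMap.weightedSumSquares ℂ w) (mk ℂ p hp) L ↔
      (w * p) ⬝ᵥ p = 0 ∧ L = mk ℂ (w * p) (mul_ne_zero_of_forall hw hp) := by
  have hwp := mul_ne_zero_of_forall hw hp
  unfold IsTangentAt
  rw [mk_mem_locus, weightedSumSquares_eq]
  refine and_congr_right fun _ => ?_
  have hpol : ∀ v, QuadraticMap.polar (QuadraticMap.weightedSumSquares ℂ w) (mk ℂ p hp).rep v = 0 ↔
      (w * p) ⬝ᵥ v = 0 := by
    intro v
    obtain ⟨c, hc⟩ := exists_smul_eq_mk_rep ℂ p hp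
    rw [polar_weightedSumSquares, ← hc, mul_smul_comm, smul_dotProduct, mul_eq_zero,
      smul_eq_zero_iff_eq]
    simp
  simp only [hpol]
  constructor
  · intro h
    rw [← mk_rep L, mk_eq_mk_iff_crossProduct_eq_zero]
    exact cross_eq_zero_of_ker_le fun v => (h v).1
  · rintro rfl v
    exact rep_dot hwp v

/-- The dual conic of a diagonal conic is diagonal, with the inverse coefficients. -/
theorem isTangent_mk {w : Fin 3 → ℂ} (hw : ∀ i, w i ≠ 0) {n : Fin 3 → ℂ} (hn : n ≠ 0) :
    IsTangent (QuadraticMap.weightedSumSquares ℂ w) (mk ℂ n hn) ↔ (w⁻¹ * n) ⬝ᵥ n = 0 := by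
  have hw' : ∀ i, w⁻¹ i ≠ 0 := fun i => inv_ne_zero (hw i)
  have hww : ∀ v : Fin 3 → ℂ, w * (w⁻¹ * v) = v := by
    intro v; funext i; simp [hw i]
  constructor
  · rintro ⟨P, hP⟩
    induction P using Projectivization.ind with | h p hp =>
    rw [isTangentAt_iff hw, mk_eq_mk_iff'] at hP
    obtain ⟨h0, c, rfl⟩ := hP
    have : w⁻¹ * (c • (w * p)) = c • p := by
      funext i; simp only [Pi.mul_apply, Pi.inv_apply, Pi.smul_apply, smul_eq_mul]
      field_simp [hw i]
    rw [this, smul_dotProduct, dotProduct_smul, dotProduct_comm, h0, smul_zero, smul_zero]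
  · intro h
    refine ⟨mk ℂ (w⁻¹ * n) (mul_ne_zero_of_forall hw' hn), ?_⟩
    rw [isTangentAt_iff hw]
    simp only [hww, and_true]
    rw [dotProduct_comm, h]

/-! ### The reflection of lines -/

/-- The reflection of the line with covector `n` about the line with covector `N`, multiplied by
`N₀² + N₁²` so that it is polynomial in both arguments. -/
def reflect (N n : Fin 3 → ℂ) : Fin 3 → ℂ :=
  (N 0 ^ 2 + N 1 ^ 2) • n - (2 * (n 0 * N 0 + n 1 * N 1)) • N

theorem reflect_reflect (N n : Fin 3 → ℂ) :
    reflect N (reflect N n) = (N 0 ^ 2 + N 1 ^ 2) ^ 2 • n := by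
  funext i
  simp [reflect]
  ring

theorem reflect_ne_zero {N n : Fin 3 → ℂ} (hN : N 0 ^ 2 + N 1 ^ 2 ≠ 0) (hn : n ≠ 0) :
    reflect N n ≠ 0 := by
  intro h
  have h1 := reflect_reflect N n
  rw [h] at h1
  have h2 : reflect N 0 = 0 := by funext i; simp [reflect]
  rw [h2, eq_comm, smul_eq_zero] at h1
  exact h1.elim (pow_ne_zero 2 hN) hn

theorem reflect_dot {N n p : Fin 3 → ℂ} (hN : N ⬝ᵥ p = 0) (hn : n ⬝ᵥ p = 0) :
    reflect N n ⬝ᵥ p = 0 := by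
  rw [reflect, sub_dotProduct, smul_dotProduct, smul_dotProduct, hN, hn]
  simp

theorem symmetricLines_reflect {N n : Fin 3 → ℂ} (hN0 : N ≠ 0) (hn : n ≠ 0)
    (hN : N 0 ^ 2 + N 1 ^ 2 ≠ 0) :
    SymmetricLines (mk ℂ N hN0) (mk ℂ n hn) (mk ℂ (reflect N n) (reflect_ne_zero hN hn)) := by
  have hiso : ¬ Line.IsIsotropic (mk ℂ N hN0) := by rwa [isIsotropic_mk]
  obtain ⟨c, hc⟩ := exists_smul_eq_mk_rep ℂ N hN0
  have hc0 : (c : ℂ) ≠ 0 := c.ne_zero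
  let σ : (Fin 3 → ℂ) →ₗ[ℂ] (Fin 3 → ℂ) :=
    { toFun := fun v => v - (2 * (N ⬝ᵥ v) / (N 0 ^ 2 + N 1 ^ 2)) • ![N 0, N 1, 0]
      map_add' := fun v w => by
        rw [dotProduct_add, mul_add, add_div, add_smul]; abel
      map_smul' := fun r v => by
        rw [dotProduct_smul, smul_eq_mul, RingHom.id_apply, smul_sub, smul_smul]
        congr 2; ring }
  have hσ : ∀ v, σ v = v - (2 * (N ⬝ᵥ v) / (N 0 ^ 2 + N 1 ^ 2)) • ![N 0, N 1, 0] := fun _ => rfl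
  refine ⟨σ, (isSymmetryAbout_iff hiso σ).2 fun v => ?_, fun v => ?_⟩
  · have hcN : ((c : ℂ) * N 0) ^ 2 + ((c : ℂ) * N 1) ^ 2 ≠ 0 := by
      rw [mul_pow, mul_pow, ← mul_add]; positivity
    rw [hσ, ← hc, Units.smul_def, smul_dotProduct]
    funext i
    fin_cases i <;> simp <;> field_simp
  · rw [rep_dot, rep_dot, hσ]
    have : reflect N n ⬝ᵥ (v - (2 * (N ⬝ᵥ v) / (N 0 ^ 2 + N 1 ^ 2)) • ![N 0, N 1, 0]) =
        (N 0 ^ 2 + N 1 ^ 2) * (n ⬝ᵥ v) := by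
      simp [reflect, dotProduct, Fin.sum_univ_three]
      field_simp
      ring
    rw [this, mul_eq_zero]
    simp [hN]

/-- The reflection law at a finite or infinite point of a non-isotropic line. -/
theorem reflectedAt_reflect {p N n : Fin 3 → ℂ} (hp : p ≠ 0) (hN0 : N ≠ 0) (hn : n ≠ 0)
    (hN : N 0 ^ 2 + N 1 ^ 2 ≠ 0) (hNp : N ⬝ᵥ p = 0) (hnp : n ⬝ᵥ p = 0) :
    ReflectedAt (mk ℂ p hp) (mk ℂ N hN0) (mk ℂ n hn)
      (mk ℂ (reflect N n) (reflect_ne_zero hN hn)) :=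
  ⟨(contains_mk _ _).2 hNp, (contains_mk _ _).2 hnp, (contains_mk _ _).2 (reflect_dot hNp hnp),
    fun _ => symmetricLines_reflect hN0 hn hN,
    fun h => absurd ((isIsotropic_mk hN0).1 h) hN⟩

theorem tendsto_mk {f : ℕ → Fin 3 → ℂ} {l : Fin 3 → ℂ} (hf : ∀ k, f k ≠ 0) (hl : l ≠ 0)
    (h : Filter.Tendsto f Filter.atTop (nhds l)) :
    Filter.Tendsto (fun k => (mk ℂ (f k) (hf k) : CP2)) Filter.atTop
      (nhds (mk ℂ l hl : CP2)) := by
  have hcont : Continuous (mk' ℂ : {v : Fin 3 → ℂ // v ≠ 0} → CP2) := continuous_coinduced_rng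
  have h2 : Filter.Tendsto (fun k => (⟨f k, hf k⟩ : {v : Fin 3 → ℂ // v ≠ 0})) Filter.atTop
      (nhds ⟨l, hl⟩) := tendsto_subtype_rng.2 h
  exact (hcont.tendsto _).comp h2

/-- At a finite point of an isotropic line `N`, every line through the point is reflected into `N`
itself: approximate `N` by non-isotropic lines through the point. -/
theorem reflectedAt_isotropic {p N n : Fin 3 → ℂ} (hp : p ≠ 0) (hN0 : N ≠ 0) (hn : n ≠ 0)
    (hN : N 0 ^ 2 + N 1 ^ 2 = 0) (hNp : N ⬝ᵥ p = 0) (hnp : n ⬝ᵥ p = 0) (hp2 : p 2 ≠ 0) :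
    ReflectedAt (mk ℂ p hp) (mk ℂ N hN0) (mk ℂ n hn) (mk ℂ N hN0) := by
  have hNp' := hNp
  have hnp' := hnp
  simp only [dotProduct, Fin.sum_univ_three] at hNp hnp
  have hN00 : N 0 ≠ 0 := by
    intro h0
    have h1 : N 1 = 0 := by rw [h0] at hN; simpa using hN
    have h2 : N 2 = 0 := by rw [h0, h1] at hNp; simpa [hp2] using hNp
    exact hN0 (by funext i; fin_cases i <;> simp [h0, h1, h2])
  -- a direction in the pencil of lines at `p` such that `N + ε u` is not isotropic for small `ε ≠ 0`
  set u : Fin 3 → ℂ := ![N 0, -N 1, -(N 0 * p 0 - N 1 * p 1) / p 2] with hu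
  have hup : u ⬝ᵥ p = 0 := by
    simp [hu, dotProduct, Fin.sum_univ_three]; field_simp; ring
  set ε : ℕ → ℂ := fun k => 1 / ((k : ℂ) + 1) with hε
  have hε0 : ∀ k, ε k ≠ 0 := fun k => one_div_ne_zero (Nat.cast_add_one_ne_zero k)
  have hεlim : Filter.Tendsto ε Filter.atTop (nhds 0) :=
    tendsto_one_div_add_atTop_nhds_zero_nat (𝕜 := ℂ)
  set f : ℕ → Fin 3 → ℂ := fun k => N + ε k • u with hf
  have hfN : ∀ k, f k 0 ^ 2 + f k 1 ^ 2 ≠ 0 := by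
    intro k
    have h0 : f k 0 = N 0 + ε k * N 0 := rfl
    have h1 : f k 1 = N 1 + ε k * -N 1 := rfl
    have : f k 0 ^ 2 + f k 1 ^ 2 = 4 * ε k * N 0 ^ 2 := by
      rw [h0, h1]
      linear_combination (1 - ε k) ^ 2 * hN
    rw [this]
    exact mul_ne_zero (mul_ne_zero (by norm_num) (hε0 k)) (pow_ne_zero 2 hN00)
  have hf0 : ∀ k, f k ≠ 0 := fun k h => hfN k (by simp [h])
  have hfp : ∀ k, f k ⬝ᵥ p = 0 := by
    intro k
    change (N + ε k • u) ⬝ᵥ p = 0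
    rw [add_dotProduct, smul_dotProduct, hup, hNp']; simp
  have hflim : Filter.Tendsto f Filter.atTop (nhds N) := by
    have : Filter.Tendsto f Filter.atTop (nhds (N + (0 : ℂ) • u)) :=
      tendsto_const_nhds.add (hεlim.smul_const u)
    simpa using this
  refine ⟨(contains_mk _ _).2 hNp', (contains_mk _ _).2 hnp', (contains_mk _ _).2 hNp',
    fun h => absurd ((isIsotropic_mk hN0).2 hN) h, fun _ => ⟨(isFinite_mk hp).2 hp2, ?_⟩⟩
  by_cases hcr : n ⨯₃ N = 0
  · -- `n` is the line `N`: every approximating line is reflected into itself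
    have hnN : (mk ℂ n hn : Line) = mk ℂ N hN0 := (mk_eq_mk_iff_crossProduct_eq_zero hn hN0).2 hcr
    have hself : ∀ k, (mk ℂ (reflect (f k) (f k)) (reflect_ne_zero (hfN k) (hf0 k)) : Line) =
        mk ℂ (f k) (hf0 k) := by
      intro k
      rw [mk_eq_mk_iff']
      refine ⟨-(f k 0 ^ 2 + f k 1 ^ 2), ?_⟩
      funext i
      simp [reflect]; ring
    refine ⟨fun _ => mk ℂ p hp, fun k => mk ℂ (f k) (hf0 k), fun k => mk ℂ (f k) (hf0 k),
      fun k => mk ℂ (f k) (hf0 k), fun k => ⟨(contains_mk _ _).2 (hfp k),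
        (contains_mk _ _).2 (hfp k), (contains_mk _ _).2 (hfp k), ?_, ?_⟩, tendsto_const_nhds,
      tendsto_mk hf0 hN0 hflim, ?_, tendsto_mk hf0 hN0 hflim⟩
    · rw [isIsotropic_mk]; exact hfN k
    · have := symmetricLines_reflect (hf0 k) (hf0 k) (hfN k)
      rwa [hself] at this
    · rw [hnN]; exact tendsto_mk hf0 hN0 hflim
  · -- the scalar product with the isotropic covector `N` vanishes only on multiples of `N`
    have hdot : n 0 * N 0 + n 1 * N 1 ≠ 0 := by
      intro h
      have e01 : n 0 * N 1 - n 1 * N 0 = 0 := by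
        apply mul_left_cancel₀ hN00
        linear_combination N 1 * h - n 1 * hN
      apply hcr
      rw [cross_apply]
      have e0 : n 1 * N 2 - n 2 * N 1 = 0 := by
        apply mul_left_cancel₀ hp2
        linear_combination n 1 * hNp - N 1 * hnp + p 0 * e01
      have e1 : n 2 * N 0 - n 0 * N 2 = 0 := by
        apply mul_left_cancel₀ hp2
        linear_combination N 0 * hnp - n 0 * hNp + p 1 * e01
      simp [e0, e1, e01]
    have hlim : Filter.Tendsto (fun k => reflect (f k) n) Filter.atTop (nhds (reflect N n)) := by
      have hc : Continuous fun M : Fin 3 → ℂ => reflect M n := by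
        unfold reflect; fun_prop
      exact (hc.tendsto N).comp hflim
    have hRN : reflect N n = (-(2 * (n 0 * N 0 + n 1 * N 1))) • N := by
      rw [reflect, hN, zero_smul, zero_sub, neg_smul]
    have hd : -(2 * (n 0 * N 0 + n 1 * N 1)) ≠ 0 := neg_ne_zero.2 (mul_ne_zero two_ne_zero hdot)
    have hR0 : reflect N n ≠ 0 := by rw [hRN]; exact smul_ne_zero hd hN0
    have hRmk : (mk ℂ (reflect N n) hR0 : Line) = mk ℂ N hN0 :=
      (mk_eq_mk_iff' _ _ _ _ _).2 ⟨_, hRN.symm⟩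
    refine ⟨fun _ => mk ℂ p hp, fun k => mk ℂ (f k) (hf0 k), fun _ => mk ℂ n hn,
      fun k => mk ℂ (reflect (f k) n) (reflect_ne_zero (hfN k) hn),
      fun k => ⟨(contains_mk _ _).2 (hfp k), (contains_mk _ _).2 hnp',
        (contains_mk _ _).2 (reflect_dot (hfp k) hnp'), ?_,
        symmetricLines_reflect (hf0 k) hn (hfN k)⟩,
      tendsto_const_nhds, tendsto_mk hf0 hN0 hflim, tendsto_const_nhds, ?_⟩
    · rw [isIsotropic_mk]; exact hfN k
    · rw [← hRmk]; exact tendsto_mk (fun k => reflect_ne_zero (hfN k) hn) hR0 hlim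

/-! ### Confocal conics -/

/-- The coefficients of the diagonal quadratic form `confocal a b μ`. -/
noncomputable def confocalCoeff (a b : ℝ) (μ : ℂ) : Fin 3 → ℂ := ![1 / ((a : ℂ) - μ), 1 / ((b : ℂ) - μ), -1]

theorem confocal_eq (a b : ℝ) (μ : ℂ) :
    confocal a b μ = QuadraticMap.weightedSumSquares ℂ (confocalCoeff a b μ) := rfl

theorem confocalCoeff_ne_zero {a b : ℝ} {μ : ℂ} (hμa : μ ≠ a) (hμb : μ ≠ b) (i : Fin 3) :
    confocalCoeff a b μ i ≠ 0 := by
  have ha : (a : ℂ) - μ ≠ 0 := sub_ne_zero.2 hμa.symm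
  have hb : (b : ℂ) - μ ≠ 0 := sub_ne_zero.2 hμb.symm
  fin_cases i <;> simp [confocalCoeff, ha, hb]

theorem confocal_dot_eq_zero_iff {a b : ℝ} {μ : ℂ} {p q : Fin 3 → ℂ} :
    (confocalCoeff a b μ * p) ⬝ᵥ q = 0 ↔
      p 0 * q 0 / (a - μ) + p 1 * q 1 / (b - μ) = p 2 * q 2 := by
  have : (confocalCoeff a b μ * p) ⬝ᵥ q =
      p 0 * q 0 / (a - μ) + p 1 * q 1 / (b - μ) - p 2 * q 2 := by
    simp [confocalCoeff, dotProduct, Fin.sum_univ_three]; ring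
  rw [this, sub_eq_zero]

theorem mk_mem_locus_confocal {a b : ℝ} {μ : ℂ} {p : Fin 3 → ℂ} (hp : p ≠ 0) :
    mk ℂ p hp ∈ locus (confocal a b μ) ↔
      p 0 * p 0 / (a - μ) + p 1 * p 1 / (b - μ) = p 2 * p 2 := by
  rw [mk_mem_locus, confocal_eq, weightedSumSquares_eq, confocal_dot_eq_zero_iff]

/-- The dual conics of the confocal conics form a pencil, spanned by the dual of `C` and the pair of
circular points. -/
theorem isTangent_confocal {a b : ℝ} {μ : ℂ} (hμa : μ ≠ a) (hμb : μ ≠ b) {n : Fin 3 → ℂ}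
    (hn : n ≠ 0) : IsTangent (confocal a b μ) (mk ℂ n hn) ↔
      ((a : ℂ) - μ) * n 0 ^ 2 + (b - μ) * n 1 ^ 2 = n 2 ^ 2 := by
  rw [confocal_eq, isTangent_mk (confocalCoeff_ne_zero hμa hμb), ← sub_eq_zero (b := n 2 ^ 2)]
  have : ((confocalCoeff a b μ)⁻¹ * n) ⬝ᵥ n =
      ((a : ℂ) - μ) * n 0 ^ 2 + (b - μ) * n 1 ^ 2 - n 2 ^ 2 := by
    simp [confocalCoeff, dotProduct, Fin.sum_univ_three]; ring
  rw [this]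

/-- Confocal conics are complex caustics of each other. -/
theorem isComplexCaustic_confocal {a b : ℝ} (ha : a ≠ 0) (hb : b ≠ 0) (hab : a ≠ b) {μ : ℂ}
    (hμa : μ ≠ a) (hμb : μ ≠ b) : IsComplexCaustic (confocal a b 0) (confocal a b μ) := by
  have haC : (a : ℂ) ≠ 0 := by exact_mod_cast ha
  have hbC : (b : ℂ) ≠ 0 := by exact_mod_cast hb
  have habC : (a : ℂ) - b ≠ 0 := sub_ne_zero.2 (by exact_mod_cast hab)
  have hw : ∀ i, confocalCoeff a b 0 i ≠ 0 := confocalCoeff_ne_zero haC.symm hbC.symm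
  intro ℓ P hℓ hℓP hPC
  induction ℓ using Projectivization.ind with | h n hn =>
  induction P using Projectivization.ind with | h p hp =>
  rw [isTangent_confocal hμa hμb] at hℓ
  have hnp : n ⬝ᵥ p = 0 := (contains_mk hn hp).1 hℓP
  have hC : (confocalCoeff a b 0 * p) ⬝ᵥ p = 0 := by
    rwa [mk_mem_locus_confocal, ← confocal_dot_eq_zero_iff] at hPC
  set N := confocalCoeff a b 0 * p with hN
  have hN0 : N ≠ 0 := mul_ne_zero_of_forall hw hp
  have htan : IsTangentAt (confocal a b 0) (mk ℂ p hp) (mk ℂ N hN0) := by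
    rw [confocal_eq, isTangentAt_iff hw hp]; exact ⟨hC, rfl⟩
  -- coordinates of the point in terms of its tangent line
  have e0 : p 0 = a * N 0 := by simp [hN, confocalCoeff]; field_simp
  have e1 : p 1 = b * N 1 := by simp [hN, confocalCoeff]; field_simp
  have e2 : p 2 = -N 2 := by simp [hN, confocalCoeff]
  have hC' := hC
  have hnp' := hnp
  simp only [dotProduct, Fin.sum_univ_three, e0, e1, e2] at hC' hnp'
  refine ⟨mk ℂ N hN0, ?_⟩
  by_cases hiso : N 0 ^ 2 + N 1 ^ 2 = 0
  · refine ⟨mk ℂ N hN0, htan, reflectedAt_isotropic hp hN0 hn hiso hC hnp ?_, ?_⟩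
    · -- the tangent lines of `C` at infinity are its asymptotes, which are not isotropic
      intro h2
      rw [e2, neg_eq_zero] at h2
      rw [h2] at hC'
      have h0 : N 0 = 0 := by
        have : ((a : ℂ) - b) * N 0 ^ 2 = 0 := by linear_combination hC' - b * hiso
        simpa [habC] using this
      have h1 : N 1 = 0 := by rw [h0] at hiso; simpa using hiso
      exact hN0 (by funext i; fin_cases i <;> simp [h0, h1, h2])
    · rw [isTangent_confocal hμa hμb]
      linear_combination hC' - μ * hiso
  · refine ⟨_, htan, reflectedAt_reflect hp hN0 hn hiso hC hnp, ?_⟩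
    rw [isTangent_confocal hμa hμb]
    simp only [reflect, Pi.sub_apply, Pi.smul_apply, smul_eq_mul]
    set s := N 0 ^ 2 + N 1 ^ 2 with hs
    set d := 2 * (n 0 * N 0 + n 1 * N 1) with hd
    linear_combination s ^ 2 * hℓ - 2 * s * d * hnp' + d ^ 2 * hC' + μ * d ^ 2 * hs -
      μ * s * d * hd

/-- The point of the complex projective plane with affine coordinates `(x, y)`. -/
noncomputable def affinePoint (x y : ℂ) : CP2 :=
  mk ℂ ![x, y, 1] (fun h => one_ne_zero (congrFun h 2))

theorem affinePoint_inj {x y x' y' : ℂ} : affinePoint x y = affinePoint x' y' ↔ x = x' ∧ y = y' := by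
  constructor
  · intro h
    obtain ⟨c, hc⟩ := (mk_eq_mk_iff' _ _ _ _ _).1 h
    have h2 := congrFun hc 2
    have h0 := congrFun hc 0
    have h1 := congrFun hc 1
    simp at h0 h1 h2
    simp [← h0, ← h1, h2]
  · rintro ⟨rfl, rfl⟩; rfl

theorem affinePoint_mem_confocal {a b : ℝ} {μ x y : ℂ} :
    affinePoint x y ∈ locus (confocal a b μ) ↔ x ^ 2 / (a - μ) + y ^ 2 / (b - μ) = 1 := by
  rw [affinePoint, mk_mem_locus_confocal]
  simp [sq]

/-- Two different confocal conics meet in four points. -/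
theorem inGeneralPosition_confocal {a b : ℝ} (ha : a ≠ 0) (hb : b ≠ 0) (hab : a ≠ b) {μ : ℂ}
    (hμa : μ ≠ a) (hμb : μ ≠ b) (hμ : μ ≠ 0) :
    InGeneralPosition (confocal a b 0) (confocal a b μ) := by
  have haC : (a : ℂ) ≠ 0 := by exact_mod_cast ha
  have hbC : (b : ℂ) ≠ 0 := by exact_mod_cast hb
  have habC : (a : ℂ) - b ≠ 0 := sub_ne_zero.2 (by exact_mod_cast hab)
  have ham : (a : ℂ) - μ ≠ 0 := sub_ne_zero.2 hμa.symm
  have hbm : (b : ℂ) - μ ≠ 0 := sub_ne_zero.2 hμb.symm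
  obtain ⟨X, hX⟩ := IsAlgClosed.exists_pow_nat_eq ((a : ℂ) * (a - μ) / (a - b)) two_pos
  obtain ⟨Y, hY⟩ := IsAlgClosed.exists_pow_nat_eq (-((b : ℂ) * (b - μ)) / (a - b)) two_pos
  have hX0 : X ≠ 0 := by
    rintro rfl
    simp [haC, habC, ham, eq_comm] at hX
  have hY0 : Y ≠ 0 := by
    rintro rfl
    simp [hbC, habC, hbm, eq_comm] at hY
  -- the intersection is symmetric about both axes
  have hset : locus (confocal a b 0) ∩ locus (confocal a b μ) =
      (fun q : ℂ × ℂ => affinePoint q.1 q.2) '' (({X, -X} : Set ℂ) ×ˢ ({Y, -Y} : Set ℂ)) := by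
    ext P
    constructor
    · induction P using Projectivization.ind with | h p hp =>
      rintro ⟨h1, h2⟩
      rw [mk_mem_locus_confocal, sub_zero, sub_zero] at h1
      rw [mk_mem_locus_confocal] at h2
      field_simp at h1 h2
      have e0 : ((a : ℂ) - b) * p 0 ^ 2 = a * (a - μ) * p 2 ^ 2 := by
        apply mul_left_cancel₀ hμ
        linear_combination (a - μ) * h1 - a * h2
      have e1 : ((a : ℂ) - b) * p 1 ^ 2 = -(b * (b - μ)) * p 2 ^ 2 := by
        apply mul_left_cancel₀ hμ
        linear_combination b * h2 - (b - μ) * h1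
      have hp2 : p 2 ≠ 0 := by
        intro h
        rw [h] at e0 e1
        have h0 : p 0 = 0 := by simpa [habC] using e0
        have h1 : p 1 = 0 := by simpa [habC] using e1
        exact hp (by funext i; fin_cases i <;> simp [h0, h1, h])
      refine ⟨(p 0 / p 2, p 1 / p 2), ⟨?_, ?_⟩, ?_⟩
      · change _ = _ ∨ _ = _
        rw [← sq_eq_sq_iff_eq_or_eq_neg, hX, div_pow, div_eq_div_iff (pow_ne_zero 2 hp2) habC]
        linear_combination e0
      · change _ = _ ∨ _ = _
        rw [← sq_eq_sq_iff_eq_or_eq_neg, hY, div_pow, div_eq_div_iff (pow_ne_zero 2 hp2) habC]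
        linear_combination e1
      · refine (mk_eq_mk_iff' _ _ _ _ _).2 ⟨(p 2)⁻¹, ?_⟩
        funext i; fin_cases i <;> simp [hp2] <;> field_simp
    · rintro ⟨⟨x, y⟩, ⟨hx, hy⟩, rfl⟩
      have hx2 : x ^ 2 = X ^ 2 := sq_eq_sq_iff_eq_or_eq_neg.2 hx
      have hy2 : y ^ 2 = Y ^ 2 := sq_eq_sq_iff_eq_or_eq_neg.2 hy
      simp only [Set.mem_inter_iff, affinePoint_mem_confocal, hx2, hy2, hX, hY, sub_zero]
      constructor <;> field_simp <;> ring
  have hinj : Function.Injective fun q : ℂ × ℂ => affinePoint q.1 q.2 := by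
    rintro ⟨x, y⟩ ⟨x', y'⟩ h
    exact Prod.ext_iff.2 (affinePoint_inj.1 h)
  rw [InGeneralPosition, hset, Set.ncard_image_of_injective _ hinj, Set.ncard_prod,
    Set.ncard_pair (self_ne_neg.2 hX0), Set.ncard_pair (self_ne_neg.2 hY0)]

/-! ### Triangles between two conics -/

theorem two_mul_trace_sq_of_diag_eq_zero {R : Type*} [CommRing R] {X Y : Matrix (Fin 3) (Fin 3) R}
    (hX : X.IsSymm) (hY : Y.IsSymm) (hX0 : ∀ i, X i i = 0) (hY0 : ∀ i, Y i i = 0) :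
    2 * (X * Y * (X * Y)).trace = (X * Y).trace ^ 2 := by
  have x0 := hX0 0
  have x1 := hX0 1
  have x2 := hX0 2
  have y0 := hY0 0
  have y1 := hY0 1
  have y2 := hY0 2
  have x10 := hX.apply 0 1
  have x20 := hX.apply 0 2
  have x21 := hX.apply 1 2
  have y10 := hY.apply 0 1
  have y20 := hY.apply 0 2
  have y21 := hY.apply 1 2
  simp only [Matrix.trace, Matrix.diag, Matrix.mul_apply, Fin.sum_univ_three, x0, x1, x2, y0, y1,
    y2, x10, x20, x21, y10, y20, y21]
  ring

/-- If a triangle, with vertices the rows of `P`, is inscribed in the conic of matrix `C` and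
circumscribed about the conic whose dual has matrix `D`, then `2 tr (C D)² = (tr C D)²`: in the
basis of the vertices both matrices have zero diagonal, the sides being the dual basis. -/
theorem two_mul_trace_sq_of_triangle {K : Type*} [Field K] {C D P : Matrix (Fin 3) (Fin 3) K}
    (hC : C.IsSymm) (hD : D.IsSymm) (hP : P.det ≠ 0) (hC0 : ∀ i, (P * C * Pᵀ) i i = 0)
    (hD0 : ∀ i, (P.adjugateᵀ * D * P.adjugate) i i = 0) :
    2 * (C * D * (C * D)).trace = (C * D).trace ^ 2 := by
  have hs1 : (P * C * Pᵀ).IsSymm := by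
    rw [Matrix.IsSymm, transpose_mul, transpose_mul, transpose_transpose, hC.eq, Matrix.mul_assoc]
  have hs2 : (P.adjugateᵀ * D * P.adjugate).IsSymm := by
    rw [Matrix.IsSymm, transpose_mul, transpose_mul, transpose_transpose, hD.eq, Matrix.mul_assoc]
  have h := two_mul_trace_sq_of_diag_eq_zero hs1 hs2 hC0 hD0
  have hPT : Pᵀ * P.adjugateᵀ = P.det • (1 : Matrix (Fin 3) (Fin 3) K) := by
    rw [← transpose_mul, adjugate_mul, transpose_smul, transpose_one]
  have e : P * C * Pᵀ * (P.adjugateᵀ * D * P.adjugate) = P.det • (P * (C * D) * P.adjugate) := by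
    calc P * C * Pᵀ * (P.adjugateᵀ * D * P.adjugate)
        = P * C * (Pᵀ * P.adjugateᵀ) * D * P.adjugate := by simp only [Matrix.mul_assoc]
      _ = _ := by simp [hPT, Matrix.mul_assoc]
  have tr : ∀ M : Matrix (Fin 3) (Fin 3) K, (P * M * P.adjugate).trace = P.det * M.trace := by
    intro M
    rw [Matrix.mul_assoc, trace_mul_comm, Matrix.mul_assoc, adjugate_mul]
    simp
  have e2 : P * (C * D) * P.adjugate * (P * (C * D) * P.adjugate) =
      P.det • (P * (C * D * (C * D)) * P.adjugate) := by
    calc P * (C * D) * P.adjugate * (P * (C * D) * P.adjugate)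
        = P * (C * D) * (P.adjugate * P) * (C * D) * P.adjugate := by simp only [Matrix.mul_assoc]
      _ = _ := by simp [adjugate_mul, Matrix.mul_assoc]
  rw [e, smul_mul_smul_comm, e2, trace_smul, trace_smul, trace_smul, tr, tr] at h
  simp only [smul_eq_mul] at h
  apply mul_left_cancel₀ (pow_ne_zero 4 hP)
  linear_combination h

/-- Two distinct points of a nondegenerate diagonal conic are not conjugate: the tangent line at a
point meets the conic only there. -/
theorem dot_ne_zero_of_cross_ne_zero {w : Fin 3 → ℂ} (hw : ∀ i, w i ≠ 0) {p q : Fin 3 → ℂ}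
    (hp : (w * p) ⬝ᵥ p = 0) (hq : (w * q) ⬝ᵥ q = 0) (h : p ⨯₃ q ≠ 0) : (w * p) ⬝ᵥ q ≠ 0 := by
  intro hpq
  have hqp : (w * q) ⬝ᵥ p = 0 := by
    rw [← hpq]; simp [dotProduct, Fin.sum_univ_three]; ring
  obtain ⟨c, hc⟩ := parallel_of_cross_eq_zero h (cross_cross_eq_zero hp hpq)
  obtain ⟨d, hd⟩ := parallel_of_cross_eq_zero h (cross_cross_eq_zero hqp hq)
  have hc' : ∀ i, p i = c * ((p ⨯₃ q) i / w i) := fun i => by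
    have := congrFun hc i
    simp only [Pi.mul_apply, Pi.smul_apply, smul_eq_mul] at this
    rw [← mul_div_assoc, ← this]; field_simp [hw i]
  have hd' : ∀ i, q i = d * ((p ⨯₃ q) i / w i) := fun i => by
    have := congrFun hd i
    simp only [Pi.mul_apply, Pi.smul_apply, smul_eq_mul] at this
    rw [← mul_div_assoc, ← this]; field_simp [hw i]
  apply h
  have key : ∀ i j, p i * q j - p j * q i = 0 := fun i j => by
    rw [hc' i, hc' j, hd' i, hd' j]; ring
  rw [cross_apply]
  simp [key]

theorem det_ne_zero_of_conic {w : Fin 3 → ℂ} (hw : ∀ i, w i ≠ 0) {v : Fin 3 → Fin 3 → ℂ}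
    (hv : ∀ i, (w * v i) ⬝ᵥ v i = 0) (h : ∀ i j, i ≠ j → v i ⨯₃ v j ≠ 0) :
    (Matrix.of v).det ≠ 0 := by
  have key : (w 0 * w 1 * w 2) * (Matrix.of v).det ^ 2 =
      2 * ((w * v 0) ⬝ᵥ v 1) * ((w * v 1) ⬝ᵥ v 2) * ((w * v 0) ⬝ᵥ v 2) := by
    have h0 := hv 0
    have h1 := hv 1
    have h2 := hv 2
    -- the Gram determinant of the three points
    have hdet : (w 0 * w 1 * w 2) * (Matrix.of v).det ^ 2 =
        (Matrix.of v * Matrix.diagonal w * (Matrix.of v)ᵀ).det := by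
      rw [det_mul, det_mul, det_transpose, det_diagonal, Fin.prod_univ_three]; ring
    have hent : ∀ i j, (Matrix.of v * Matrix.diagonal w * (Matrix.of v)ᵀ) i j = (w * v i) ⬝ᵥ v j := by
      intro i j
      simp [Matrix.mul_apply, Matrix.diagonal, dotProduct, Fin.sum_univ_three]; ring
    have hsym : ∀ i j, (w * v i) ⬝ᵥ v j = (w * v j) ⬝ᵥ v i := by
      intro i j
      simp [dotProduct, Fin.sum_univ_three]; ring
    rw [hdet, det_fin_three]
    simp only [hent, h0, h1, h2, hsym 1 0, hsym 2 0, hsym 2 1]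
    ring
  have hn : ∀ i j, i ≠ j → (w * v i) ⬝ᵥ v j ≠ 0 := fun i j hij =>
    dot_ne_zero_of_cross_ne_zero hw (hv i) (hv j) (h i j hij)
  intro h0
  rw [h0] at key
  have := mul_ne_zero (mul_ne_zero (mul_ne_zero two_ne_zero (hn 0 1 (by decide)))
    (hn 1 2 (by decide))) (hn 0 2 (by decide))
  exact this (by rw [← key]; ring)

/-- A triangle inscribed in `C` and circumscribed about a confocal conic forces the condition of
Cayley, in terms of `k = (a - μ) / a` and `l = (b - μ) / b`. -/
theorem cayley_of_circumscribed {a b : ℝ} (ha : a ≠ 0) (hb : b ≠ 0) {μ : ℂ} (hμa : μ ≠ a)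
    (hμb : μ ≠ b) {p : ZMod 3 → CP2} (hmem : ∀ j, p j ∈ locus (confocal a b 0))
    (h : IsCircumscribedPolygon (confocal a b μ) 3 p) :
    2 * ((((a : ℂ) - μ) / a) ^ 2 + (((b : ℂ) - μ) / b) ^ 2 + 1) =
      (((a : ℂ) - μ) / a + ((b : ℂ) - μ) / b + 1) ^ 2 := by
  have haC : (a : ℂ) ≠ 0 := by exact_mod_cast ha
  have hbC : (b : ℂ) ≠ 0 := by exact_mod_cast hb
  obtain ⟨hinj, htan⟩ := h
  set v : Fin 3 → Fin 3 → ℂ := fun j => (p j).rep with hv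
  have hv0 : ∀ j, v j ≠ 0 := fun j => (p j).rep_nonzero
  have hpv : ∀ j : Fin 3, mk ℂ (v j) (hv0 j) = p j := fun j => mk_rep (p j)
  have hcross : ∀ i j, i ≠ j → v i ⨯₃ v j ≠ 0 := by
    intro i j hij hc
    rw [← mk_eq_mk_iff_crossProduct_eq_zero (hv0 i) (hv0 j), hpv, hpv] at hc
    exact hij (hinj hc)
  have hC : ∀ i, (confocalCoeff a b 0 * v i) ⬝ᵥ v i = 0 := by
    intro i
    have := hmem i
    rwa [← hpv, mk_mem_locus_confocal, ← confocal_dot_eq_zero_iff] at this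
  have hD : ∀ i j : Fin 3, j = i + 1 →
      ((a : ℂ) - μ) * (v i ⨯₃ v j) 0 ^ 2 + (b - μ) * (v i ⨯₃ v j) 1 ^ 2 = (v i ⨯₃ v j) 2 ^ 2 := by
    rintro i j hij
    have hne : i ≠ j := by
      rintro rfl
      revert hij
      revert i
      decide
    have h1 := ((htan i (lineThrough (p i) (p j))).2 (Or.inr (by rw [hij]; rfl))).1
    have h2 : lineThrough (p i) (p j) = mk ℂ (v i ⨯₃ v j) (hcross i j hne) := by
      rw [← lineThrough_mk (hv0 i) (hv0 j), hpv, hpv]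
    rwa [h2, isTangent_confocal hμa hμb] at h1
  have hdet := det_ne_zero_of_conic (confocalCoeff_ne_zero haC.symm hbC.symm) hC hcross
  have hmain := two_mul_trace_sq_of_triangle (C := Matrix.diagonal (confocalCoeff a b 0))
    (D := Matrix.diagonal ![(a : ℂ) - μ, b - μ, -1]) (isSymm_diagonal _) (isSymm_diagonal _) hdet
    (fun i => by
      refine Eq.trans ?_ (hC i)
      simp [Matrix.mul_apply, Matrix.diagonal, dotProduct, Fin.sum_univ_three]; ring)
    (fun i => by
      have d0 := hD 1 2 rfl
      have d1 := hD 2 0 rfl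
      have d2 := hD 0 1 rfl
      simp only [cross_apply, Matrix.cons_val_zero, Matrix.cons_val_one, Matrix.cons_val] at d0 d1 d2
      fin_cases i
      · simp [Matrix.mul_apply, Matrix.diagonal, Fin.sum_univ_three, adjugate_fin_three]
        linear_combination d0
      · simp [Matrix.mul_apply, Matrix.diagonal, Fin.sum_univ_three, adjugate_fin_three]
        linear_combination d1
      · simp [Matrix.mul_apply, Matrix.diagonal, Fin.sum_univ_three, adjugate_fin_three]
        linear_combination d2)
  rw [diagonal_mul_diagonal, diagonal_mul_diagonal, trace_diagonal, trace_diagonal,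
    Fin.sum_univ_three, Fin.sum_univ_three] at hmain
  simp [confocalCoeff] at hmain
  linear_combination hmain

/-! ### Construction of a triangular orbit -/

/-- At most two lines through a given point are tangent to a nondegenerate conic: this is the
statement that three points of the dual conic are not collinear. -/
theorem IsTangent.eq_or_eq {w : Fin 3 → ℂ} (hw : ∀ i, w i ≠ 0) {P : CP2} {ℓ ℓ₁ ℓ₂ : Line}
    (h : IsTangent (QuadraticMap.weightedSumSquares ℂ w) ℓ)
    (h₁ : IsTangent (QuadraticMap.weightedSumSquares ℂ w) ℓ₁)
    (h₂ : IsTangent (QuadraticMap.weightedSumSquares ℂ w) ℓ₂) (hP : ℓ.Contains P)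
    (hP₁ : ℓ₁.Contains P) (hP₂ : ℓ₂.Contains P) (hne : ℓ₁ ≠ ℓ₂) : ℓ = ℓ₁ ∨ ℓ = ℓ₂ := by
  induction P using Projectivization.ind with | h p hp =>
  induction ℓ using Projectivization.ind with | h n hn =>
  induction ℓ₁ using Projectivization.ind with | h n₁ hn₁ =>
  induction ℓ₂ using Projectivization.ind with | h n₂ hn₂ =>
  rw [isTangent_mk hw] at h h₁ h₂
  rw [contains_mk] at hP hP₁ hP₂
  rw [Ne, mk_eq_mk_iff_crossProduct_eq_zero] at hne
  rw [mk_eq_mk_iff_crossProduct_eq_zero, mk_eq_mk_iff_crossProduct_eq_zero]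
  by_contra! hcon
  have hsymm : ∀ {u v : Fin 3 → ℂ}, u ⨯₃ v ≠ 0 → v ⨯₃ u ≠ 0 := by
    intro u v huv
    rwa [← cross_anticomm, neg_ne_zero]
  refine det_ne_zero_of_conic (w := w⁻¹) (v := ![n, n₁, n₂]) (fun i => inv_ne_zero (hw i)) ?_ ?_ ?_
  · intro i; fin_cases i
    exacts [h, h₁, h₂]
  · intro i j hij
    fin_cases i <;> fin_cases j
    exacts [absurd rfl hij, hcon.1, hcon.2, hsymm hcon.1, absurd rfl hij, hne, hsymm hcon.2,
      hsymm hne, absurd rfl hij]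
  · refine exists_mulVec_eq_zero_iff.1 ⟨p, hp, ?_⟩
    funext i; fin_cases i
    exacts [hP, hP₁, hP₂]

theorem reflect_smul (N n : Fin 3 → ℂ) (c : ℂ) : reflect N (c • n) = c • reflect N n := by
  funext i
  simp [reflect]
  ring

theorem reflect_cross_symm {N n n' : Fin 3 → ℂ} (hn' : n' ≠ 0) (h : reflect N n ⨯₃ n' = 0)
    (hN : N 0 ^ 2 + N 1 ^ 2 ≠ 0) (hn : n ≠ 0) : reflect N n' ⨯₃ n = 0 := by
  obtain ⟨c, hc⟩ := parallel_of_cross_eq_zero hn' h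
  have hc0 : c ≠ 0 := by
    rintro rfl
    exact reflect_ne_zero hN hn (by simpa using hc)
  have h1 := reflect_reflect N n
  rw [hc, reflect_smul] at h1
  have h2 : c • (reflect N n' ⨯₃ n) = 0 := by
    rw [← LinearMap.smul_apply, ← map_smul, h1, map_smul, LinearMap.smul_apply, _root_.cross_self,
      smul_zero]
  exact (smul_eq_zero.1 h2).resolve_left hc0

theorem reflectedAt_of_cross {p N n n' : Fin 3 → ℂ} (hp : p ≠ 0) (hN0 : N ≠ 0) (hn : n ≠ 0)
    (hn' : n' ≠ 0) (hN : N 0 ^ 2 + N 1 ^ 2 ≠ 0) (hNp : N ⬝ᵥ p = 0) (hnp : n ⬝ᵥ p = 0)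
    (h : reflect N n ⨯₃ n' = 0) :
    ReflectedAt (mk ℂ p hp) (mk ℂ N hN0) (mk ℂ n hn) (mk ℂ n' hn') := by
  rw [← (mk_eq_mk_iff_crossProduct_eq_zero (reflect_ne_zero hN hn) hn').2 h]
  exact reflectedAt_reflect hp hN0 hn hN hNp hnp

/-- A triangle inscribed in a nondegenerate conic is circumscribed about another one as soon as its
sides are tangent to it. -/
theorem isCircumscribedPolygon_of_sides {w w' : Fin 3 → ℂ} (hw : ∀ i, w i ≠ 0)
    (hw' : ∀ i, w' i ≠ 0) {v : ZMod 3 → Fin 3 → ℂ} (hv : ∀ j, v j ≠ 0)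
    (hC : ∀ j, (w * v j) ⬝ᵥ v j = 0) (hcr : ∀ i j, i ≠ j → v i ⨯₃ v j ≠ 0)
    (hD : ∀ j, (w'⁻¹ * (v j ⨯₃ v (j + 1))) ⬝ᵥ (v j ⨯₃ v (j + 1)) = 0) :
    IsCircumscribedPolygon (QuadraticMap.weightedSumSquares ℂ w') 3 (fun j => mk ℂ (v j) (hv j)) := by
  have hinj : Function.Injective fun j : ZMod 3 => (mk ℂ (v j) (hv j) : CP2) := by
    intro i j hij
    by_contra hne
    exact hcr i j hne ((mk_eq_mk_iff_crossProduct_eq_zero _ _).1 hij)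
  have hne1 : ∀ j : ZMod 3, j ≠ j + 1 := by decide
  have hne2 : ∀ j : ZMod 3, j - 1 ≠ j := by decide
  have hne3 : ∀ j : ZMod 3, j - 1 ≠ j + 1 := by decide
  have hsucc : ∀ j : ZMod 3, j - 1 + 1 = j := by decide
  have htan : ∀ j, IsTangent (QuadraticMap.weightedSumSquares ℂ w')
      (lineThrough (mk ℂ (v j) (hv j)) (mk ℂ (v (j + 1)) (hv (j + 1)))) := by
    intro j
    rw [lineThrough_mk _ _ (hcr _ _ (hne1 j)), isTangent_mk hw']
    exact hD j
  have htan' : ∀ j, IsTangent (QuadraticMap.weightedSumSquares ℂ w')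
      (lineThrough (mk ℂ (v (j - 1)) (hv (j - 1))) (mk ℂ (v j) (hv j))) := by
    intro j
    have := htan (j - 1)
    simpa only [hsucc] using this
  refine ⟨hinj, fun j ℓ => ?_⟩
  have hc1 : (lineThrough (mk ℂ (v j) (hv j)) (mk ℂ (v (j + 1)) (hv (j + 1)))).Contains
      (mk ℂ (v j) (hv j)) := by
    rw [lineThrough_mk _ _ (hcr _ _ (hne1 j)), contains_mk, dotProduct_comm, dot_self_cross]
  have hc2 : (lineThrough (mk ℂ (v (j - 1)) (hv (j - 1))) (mk ℂ (v j) (hv j))).Contains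
      (mk ℂ (v j) (hv j)) := by
    rw [lineThrough_mk _ _ (hcr _ _ (hne2 j)), contains_mk, dotProduct_comm, dot_cross_self]
  -- the vertices of the triangle are not collinear, so that the two sides are distinct
  have hsides : lineThrough (mk ℂ (v (j - 1)) (hv (j - 1))) (mk ℂ (v j) (hv j)) ≠
      lineThrough (mk ℂ (v j) (hv j)) (mk ℂ (v (j + 1)) (hv (j + 1))) := by
    rw [lineThrough_mk _ _ (hcr _ _ (hne1 j)), lineThrough_mk _ _ (hcr _ _ (hne2 j)), Ne,
      mk_eq_mk_iff_crossProduct_eq_zero]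
    intro h
    obtain ⟨c, hc⟩ := parallel_of_cross_eq_zero (hcr _ _ (hne1 j)) h
    refine det_ne_zero_of_conic (v := ![v (j - 1), v j, v (j + 1)]) hw ?_ ?_ ?_
    · intro i; fin_cases i
      exacts [hC _, hC _, hC _]
    · intro i k hik
      fin_cases i <;> fin_cases k
      exacts [absurd rfl hik, hcr _ _ (hne2 j), hcr _ _ (hne3 j), hcr _ _ (hne2 j).symm,
        absurd rfl hik, hcr _ _ (hne1 j), hcr _ _ (hne3 j).symm, hcr _ _ (hne1 j).symm,
        absurd rfl hik]
    · refine exists_mulVec_eq_zero_iff.1 ⟨_, hcr _ _ (hne2 j), ?_⟩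
      funext i; fin_cases i
      · exact dot_self_cross _ _
      · exact dot_cross_self _ _
      · change v (j + 1) ⬝ᵥ (v (j - 1) ⨯₃ v j) = 0
        rw [hc, dotProduct_smul, dot_cross_self, smul_zero]
  constructor
  · rintro ⟨h1, h2⟩
    exact h1.eq_or_eq hw' (htan' j) (htan j) h2 hc2 hc1 hsides
  · rintro (rfl | rfl)
    · exact ⟨htan' j, hc2⟩
    · exact ⟨htan j, hc1⟩

theorem isPeriodicOrbit_mk {w : Fin 3 → ℂ} (hw : ∀ i, w i ≠ 0) {v : ZMod 3 → Fin 3 → ℂ}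
    (hv : ∀ j, v j ≠ 0) (hC : ∀ j, (w * v j) ⬝ᵥ v j = 0) (hcr : ∀ i j, i ≠ j → v i ⨯₃ v j ≠ 0)
    (hiso : ∀ j, (w * v j) 0 ^ 2 + (w * v j) 1 ^ 2 ≠ 0)
    (hr : ∀ j, reflect (w * v j) (v (j - 1) ⨯₃ v j) ⨯₃ (v j ⨯₃ v (j + 1)) = 0) :
    IsPeriodicOrbit (QuadraticMap.weightedSumSquares ℂ w) 3 (fun j => mk ℂ (v j) (hv j)) where
  mem j := by rw [mk_mem_locus, weightedSumSquares_eq]; exact hC j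
  consecutive_ne j := by
    rw [Ne, mk_eq_mk_iff_crossProduct_eq_zero]
    exact hcr _ _ ((by decide : ∀ j : ZMod 3, j ≠ j + 1) j)
  tangent_not_isotropic j L hL := by
    rw [isTangentAt_iff hw] at hL
    rw [hL.2, isIsotropic_mk]
    exact hiso j
  reflected j := by
    have h1 := hcr _ _ ((by decide : ∀ j : ZMod 3, j ≠ j + 1) j)
    have h2 := hcr _ _ ((by decide : ∀ j : ZMod 3, j - 1 ≠ j) j)
    refine ⟨_, (isTangentAt_iff hw (hv j) _).2 ⟨hC j, rfl⟩, ?_⟩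
    rw [lineThrough_mk _ _ h1, lineThrough_mk _ _ h2]
    refine reflectedAt_of_cross _ _ h2 h1 (hiso j) (hC j) ?_ (hr j)
    rw [dotProduct_comm, dot_cross_self]

/-- At the vertex `(A X, y)` of the isosceles triangle with vertices `(A, 0)`, `(A X, ± y)`, inscribed
in `x² / A² + y² / b = 1`, the side from `(A, 0)` is reflected into the vertical side. -/
theorem reflect_isosceles {A b X y : ℂ} (hA : A ≠ 0) (hb : b ≠ 0) (hX1 : X + 1 ≠ 0)
    (hy : y ^ 2 = b * (1 - X ^ 2)) (hX : b * (X ^ 2 + 2 * X) + A ^ 2 * (1 - X ^ 2) = 0) :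
    reflect ![X / A, y / b, -1] ![-y, A * (X - 1), A * y] ⨯₃ ![1, 0, -(A * X)] = 0 := by
  set S := (X / A) ^ 2 + (y / b) ^ 2 with hSdef
  set d := 2 * (-y * (X / A) + A * (X - 1) * (y / b)) with hddef
  have hS : S * A ^ 2 = -2 * X := by
    rw [hSdef]; field_simp
    linear_combination A ^ 2 * hy + b * hX
  have hd : d * (A * (X + 1)) = 2 * y * X := by
    rw [hddef]; field_simp
    linear_combination -y * hX
  have hq : A * (X + 1) ≠ 0 := mul_ne_zero hA hX1
  have hr : reflect ![X / A, y / b, -1] ![-y, A * (X - 1), A * y] =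
      ![S * -y - d * (X / A), S * (A * (X - 1)) - d * (y / b), S * (A * y) + d] := by
    funext i; fin_cases i <;> simp [reflect, hSdef, hddef]
  clear_value S d
  have hXA : A * (X / A) = X := by field_simp
  have hyb : b * (y / b) = y := by field_simp
  have h1 : S * (A * (X - 1)) - d * (y / b) = 0 := by
    apply mul_left_cancel₀ (mul_ne_zero hq hb)
    linear_combination b * (X ^ 2 - 1) * hS - y * hd - 2 * X * hy - d * (A * (X + 1)) * hyb
  have h2 : (S * (A * y) + d) + A * X * (S * -y - d * (X / A)) = 0 := by
    apply mul_left_cancel₀ hq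
    linear_combination y * (1 - X ^ 2) * hS + (1 - X ^ 2) * hd - d * X * (A * (X + 1)) * hXA
  rw [hr, cross_apply]
  simp only [Matrix.cons_val_zero, Matrix.cons_val_one, Matrix.cons_val]
  funext i; fin_cases i
  · simp [h1]
  · simp only [Fin.mk_one, Matrix.cons_val_one, Matrix.cons_val_zero, Pi.zero_apply, Fin.isValue]
    linear_combination h2
  · simp [h1]

/-- If `(a - μ) / a = X²` and `(b - μ) / b = (1 + X)²`, an isosceles triangle with a vertex on the
`x`-axis is an orbit circumscribed about `confocal a b μ`. -/
theorem exists_triangular_orbit {a b : ℝ} (ha : a ≠ 0) (hb : b ≠ 0) {μ X : ℂ} (hμa : μ ≠ a)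
    (hμb : μ ≠ b) (hk : (a : ℂ) - μ = a * X ^ 2) (hl : (b : ℂ) - μ = b * (1 + X) ^ 2) :
    ∃ p : ZMod 3 → CP2, IsPeriodicOrbit (confocal a b 0) 3 p ∧
      IsCircumscribedPolygon (confocal a b μ) 3 p := by
  have haC : (a : ℂ) ≠ 0 := by exact_mod_cast ha
  have hbC : (b : ℂ) ≠ 0 := by exact_mod_cast hb
  obtain ⟨A, hA⟩ := IsAlgClosed.exists_pow_nat_eq (a : ℂ) two_pos
  obtain ⟨y, hy⟩ := IsAlgClosed.exists_pow_nat_eq ((b : ℂ) * (1 - X ^ 2)) two_pos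
  have hA0 : A ≠ 0 := by rintro rfl; exact haC (by simpa using hA.symm)
  have hX0 : X ≠ 0 := by rintro rfl; exact hμa (by linear_combination -hk)
  have hXm : X + 1 ≠ 0 := by
    intro h; exact hμb (by linear_combination -hl - b * (1 + X) * h)
  -- `X = 1` would give `μ = 0` and `b = 4 b`
  have hXp : X - 1 ≠ 0 := by
    intro h
    have hX1 : X = 1 := by linear_combination h
    rw [hX1] at hk hl
    exact hbC (by linear_combination (hl - hk) / (-3))
  have hX : (b : ℂ) * (X ^ 2 + 2 * X) + A ^ 2 * (1 - X ^ 2) = 0 := by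
    rw [hA]; linear_combination hk - hl
  have hy0 : y ≠ 0 := by
    rintro rfl
    have : (b : ℂ) * ((X - 1) * (X + 1)) = 0 := by linear_combination hy
    simp [hbC, hXm, hXp] at this
  have hw := confocalCoeff_ne_zero (a := a) (b := b) haC.symm hbC.symm
  have hw' := confocalCoeff_ne_zero hμa hμb
  set v : ZMod 3 → Fin 3 → ℂ := ![![A, 0, 1], ![A * X, y, 1], ![A * X, -y, 1]] with hvdef
  have v0 : v 0 = ![A, 0, 1] := rfl
  have v1 : v 1 = ![A * X, y, 1] := rfl
  have v2 : v 2 = ![A * X, -y, 1] := rfl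
  have hall : ∀ {Q : ZMod 3 → Prop}, Q 0 → Q 1 → Q 2 → ∀ j, Q j := by
    intro Q h0 h1 h2 j
    fin_cases j
    exacts [h0, h1, h2]
  have c01 : v 0 ⨯₃ v 1 = ![-y, A * (X - 1), A * y] := by
    rw [v0, v1, cross_apply]; funext i; fin_cases i <;> simp; ring
  have c20 : v 2 ⨯₃ v 0 = (-1 : ℂ) • ![- -y, A * (X - 1), A * -y] := by
    rw [v0, v2, cross_apply]; funext i; fin_cases i <;> simp <;> ring
  have c12 : v 1 ⨯₃ v 2 = (2 * y) • ![1, 0, -(A * X)] := by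
    rw [v1, v2, cross_apply]; funext i; fin_cases i <;> simp <;> ring
  have hn1 : ∀ z : ℂ, ![-z, A * (X - 1), A * z] ≠ 0 := fun z h =>
    mul_ne_zero hA0 hXp (congrFun h 1)
  have hn2 : ![1, 0, -(A * X)] ≠ 0 := fun h => one_ne_zero (congrFun h 0)
  have n01 : v 0 ⨯₃ v 1 ≠ 0 := by rw [c01]; exact hn1 y
  have n20 : v 2 ⨯₃ v 0 ≠ 0 := by rw [c20]; exact smul_ne_zero (by norm_num) (hn1 (-y))
  have n12 : v 1 ⨯₃ v 2 ≠ 0 := by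
    rw [c12]; exact smul_ne_zero (mul_ne_zero two_ne_zero hy0) hn2
  have hsymm : ∀ {u v : Fin 3 → ℂ}, u ⨯₃ v ≠ 0 → v ⨯₃ u ≠ 0 := by
    intro u v huv
    rwa [← cross_anticomm, neg_ne_zero]
  have hv : ∀ j, v j ≠ 0 := hall (fun h => one_ne_zero (congrFun h 2))
    (fun h => one_ne_zero (congrFun h 2)) (fun h => one_ne_zero (congrFun h 2))
  have hcr : ∀ i j, i ≠ j → v i ⨯₃ v j ≠ 0 :=
    hall (hall (absurd rfl) (fun _ => n01) (fun _ => hsymm n20))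
      (hall (fun _ => hsymm n01) (absurd rfl) (fun _ => n12))
      (hall (fun _ => n20) (fun _ => hsymm n12) (absurd rfl))
  -- the tangent lines at the vertices
  have w0 : confocalCoeff a b 0 * v 0 = ![1 / A, 0, -1] := by
    rw [v0]; funext i; fin_cases i <;> simp [confocalCoeff, ← hA]
    field_simp
  have hwy : ∀ z, confocalCoeff a b 0 * ![A * X, z, 1] = ![X / A, z / b, -1] := by
    intro z; funext i; fin_cases i <;> simp [confocalCoeff, ← hA] <;> field_simp
  have hC1 : ∀ z, z ^ 2 = b * (1 - X ^ 2) →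
      (confocalCoeff a b 0 * ![A * X, z, 1]) ⬝ᵥ ![A * X, z, 1] = 0 := by
    intro z hz
    rw [hwy]
    simp [dotProduct, Fin.sum_univ_three]
    field_simp
    linear_combination hz
  have hy' : (-y) ^ 2 = (b : ℂ) * (1 - X ^ 2) := by rw [neg_sq, hy]
  have hC : ∀ j, (confocalCoeff a b 0 * v j) ⬝ᵥ v j = 0 := by
    refine hall ?_ (hC1 y hy) (hC1 (-y) hy')
    rw [w0, v0]
    simp [dotProduct, Fin.sum_univ_three, hA0]
  have hS : ∀ z, z ^ 2 = b * (1 - X ^ 2) → (X / A) ^ 2 + (z / (b : ℂ)) ^ 2 ≠ 0 := by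
    intro z hz h
    have h1 : ((X / A) ^ 2 + (z / (b : ℂ)) ^ 2) * A ^ 2 = -2 * X := by
      field_simp
      linear_combination A ^ 2 * hz + b * hX
    rw [h] at h1
    exact hX0 (by linear_combination h1 / 2)
  have hiso : ∀ j, (confocalCoeff a b 0 * v j) 0 ^ 2 + (confocalCoeff a b 0 * v j) 1 ^ 2 ≠ 0 := by
    refine hall ?_ ?_ ?_
    · rw [w0]; simp [hA0]
    · rw [v1, hwy]; exact hS y hy
    · rw [v2, hwy]; exact hS (-y) hy'
  have hdual : ∀ n : Fin 3 → ℂ, ((a : ℂ) - μ) * n 0 ^ 2 + (b - μ) * n 1 ^ 2 = n 2 ^ 2 →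
      ((confocalCoeff a b μ)⁻¹ * n) ⬝ᵥ n = 0 := by
    intro n hn
    simp [confocalCoeff, dotProduct, Fin.sum_univ_three]
    linear_combination hn
  have hD1 : ∀ z, z ^ 2 = b * (1 - X ^ 2) →
      ((a : ℂ) - μ) * (-z) ^ 2 + (b - μ) * (A * (X - 1)) ^ 2 = (A * z) ^ 2 := by
    intro z hz
    rw [hk, hl, neg_sq, mul_pow, mul_pow, hA, hz]
    ring
  refine ⟨fun j => mk ℂ (v j) (hv j), isPeriodicOrbit_mk hw hv hC hcr hiso ?_,
    isCircumscribedPolygon_of_sides hw hw' hv hC hcr ?_⟩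
  · have r1 := reflect_isosceles hA0 hbC hXm hy hX
    have r2 := reflect_isosceles hA0 hbC hXm hy' hX
    refine hall ?_ ?_ ?_
    · change reflect (confocalCoeff a b 0 * v 0) (v 2 ⨯₃ v 0) ⨯₃ (v 0 ⨯₃ v 1) = 0
      rw [w0, c20, c01, cross_apply]
      funext i; fin_cases i <;> simp [reflect] <;> field_simp <;> ring
    · change reflect (confocalCoeff a b 0 * v 1) (v 0 ⨯₃ v 1) ⨯₃ (v 1 ⨯₃ v 2) = 0
      rw [c01, c12, v1, hwy, map_smul, r1, smul_zero]
    · change reflect (confocalCoeff a b 0 * v 2) (v 1 ⨯₃ v 2) ⨯₃ (v 2 ⨯₃ v 0) = 0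
      have r2' := reflect_cross_symm hn2 r2 (by simpa using hS (-y) hy') (hn1 (-y))
      rw [c20, c12, v2, hwy, reflect_smul, map_smul, map_smul, LinearMap.smul_apply, r2', smul_zero,
        smul_zero]
  · refine hall ?_ ?_ ?_
    · change ((confocalCoeff a b μ)⁻¹ * (v 0 ⨯₃ v 1)) ⬝ᵥ (v 0 ⨯₃ v 1) = 0
      rw [c01]
      exact hdual _ (hD1 y hy)
    · change ((confocalCoeff a b μ)⁻¹ * (v 1 ⨯₃ v 2)) ⬝ᵥ (v 1 ⨯₃ v 2) = 0
      rw [c12, mul_smul_comm, smul_dotProduct, dotProduct_smul, hdual, smul_zero, smul_zero]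
      simp [hk]
      linear_combination -(X ^ 2) * hA
    · change ((confocalCoeff a b μ)⁻¹ * (v 2 ⨯₃ v 0)) ⬝ᵥ (v 2 ⨯₃ v 0) = 0
      have h := hdual ![- -y, A * (X - 1), A * -y] (hD1 (-y) hy')
      rw [c20, mul_smul_comm, smul_dotProduct, dotProduct_smul, h, smul_zero, smul_zero]

/-! ### The two parameters -/

section Parameters

variable {a b : ℝ}

theorem discriminant_pos (ha : a ≠ 0) : 0 < a ^ 2 - a * b + b ^ 2 := by
  have : 0 < a ^ 2 := by positivity
  nlinarith [sq_nonneg (a - 2 * b)]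

theorem sq_sqrt_discriminant (ha : a ≠ 0) :
    √(a ^ 2 - a * b + b ^ 2) ^ 2 = a ^ 2 - a * b + b ^ 2 :=
  Real.sq_sqrt (discriminant_pos ha).le

theorem lambdaPlus_comm (a b : ℝ) : lambdaPlus a b = lambdaPlus b a := by
  unfold lambdaPlus
  rw [show a ^ 2 - a * b + b ^ 2 = b ^ 2 - b * a + a ^ 2 by ring, ← neg_sub b a, neg_sq]
  ring

theorem lambdaMinus_comm (a b : ℝ) : lambdaMinus a b = lambdaMinus b a := by
  unfold lambdaMinus
  rw [show a ^ 2 - a * b + b ^ 2 = b ^ 2 - b * a + a ^ 2 by ring, ← neg_sub b a, neg_sq]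
  ring

theorem sq_mul_lambdaPlus (hab : a ≠ b) :
    (a - b) ^ 2 * lambdaPlus a b = -(a * b) * (a + b + 2 * √(a ^ 2 - a * b + b ^ 2)) := by
  have := sub_ne_zero.2 hab
  unfold lambdaPlus
  field_simp

theorem sq_mul_lambdaMinus (hab : a ≠ b) :
    (a - b) ^ 2 * lambdaMinus a b = -(a * b) * (a + b - 2 * √(a ^ 2 - a * b + b ^ 2)) := by
  have := sub_ne_zero.2 hab
  unfold lambdaMinus
  field_simp

theorem lambdaPlus_mul (ha : a ≠ 0) (hab : a ≠ b) :
    lambdaPlus a b * (2 * √(a ^ 2 - a * b + b ^ 2) - (a + b)) = -3 * (a * b) := by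
  apply mul_left_cancel₀ (pow_ne_zero 2 (sub_ne_zero.2 hab))
  linear_combination (2 * √(a ^ 2 - a * b + b ^ 2) - (a + b)) * sq_mul_lambdaPlus hab -
    4 * (a * b) * sq_sqrt_discriminant (b := b) ha

theorem lambdaMinus_mul (ha : a ≠ 0) (hab : a ≠ b) :
    lambdaMinus a b * (2 * √(a ^ 2 - a * b + b ^ 2) + (a + b)) = 3 * (a * b) := by
  apply mul_left_cancel₀ (pow_ne_zero 2 (sub_ne_zero.2 hab))
  linear_combination (2 * √(a ^ 2 - a * b + b ^ 2) + (a + b)) * sq_mul_lambdaMinus hab +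
    4 * (a * b) * sq_sqrt_discriminant (b := b) ha

theorem abs_lt_two_mul_sqrt {x : ℝ} (hx : x ^ 2 < 4 * (a ^ 2 - a * b + b ^ 2)) :
    |x| < 2 * √(a ^ 2 - a * b + b ^ 2) := by
  have h0 : 0 ≤ a ^ 2 - a * b + b ^ 2 := by nlinarith [sq_nonneg x]
  apply abs_lt_of_sq_lt_sq
  · rw [mul_pow, Real.sq_sqrt h0]; linarith
  · positivity

theorem abs_add_lt (hab : a ≠ b) : |a + b| < 2 * √(a ^ 2 - a * b + b ^ 2) :=
  abs_lt_two_mul_sqrt (by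
    have : 0 < (a - b) ^ 2 := by have := sub_ne_zero.2 hab; positivity
    nlinarith)

theorem abs_two_mul_sub_lt (hb : b ≠ 0) : |2 * a - b| < 2 * √(a ^ 2 - a * b + b ^ 2) :=
  abs_lt_two_mul_sqrt (by
    have : 0 < b ^ 2 := by positivity
    nlinarith)

theorem abs_two_mul_sub_lt' (ha : a ≠ 0) : |2 * b - a| < 2 * √(a ^ 2 - a * b + b ^ 2) :=
  abs_lt_two_mul_sqrt (by
    have : 0 < a ^ 2 := by positivity
    nlinarith)

theorem lambdaPlus_ne_lambdaMinus (ha : a ≠ 0) (hb : b ≠ 0) (hab : a ≠ b) :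
    lambdaPlus a b ≠ lambdaMinus a b := by
  intro h
  have h1 := sq_mul_lambdaPlus hab
  rw [h, sq_mul_lambdaMinus hab] at h1
  have hr : √(a ^ 2 - a * b + b ^ 2) ≠ 0 := (Real.sqrt_pos.2 (discriminant_pos ha)).ne'
  have h2 : a * b * √(a ^ 2 - a * b + b ^ 2) = 0 := by linear_combination h1 / 4
  exact mul_ne_zero (mul_ne_zero ha hb) hr h2

/-- `λ₊` and `λ₋` are the roots of the quadratic equation to which the condition of Cayley reduces. -/
theorem quadratic_eq_mul (ha : a ≠ 0) (hab : a ≠ b) (μ : ℂ) :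
    ((a : ℂ) - b) ^ 2 * μ ^ 2 + 2 * (a * b) * (a + b) * μ - 3 * (a * b) ^ 2 =
      ((a : ℂ) - b) ^ 2 * ((μ - lambdaPlus a b) * (μ - lambdaMinus a b)) := by
  have hd : (a - b) ^ 2 ≠ 0 := pow_ne_zero 2 (sub_ne_zero.2 hab)
  have hsum : (a - b) ^ 2 * (lambdaPlus a b + lambdaMinus a b) = -2 * (a * b) * (a + b) := by
    linear_combination sq_mul_lambdaPlus hab + sq_mul_lambdaMinus hab
  have hprod : (a - b) ^ 2 * (lambdaPlus a b * lambdaMinus a b) = -3 * (a * b) ^ 2 := by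
    apply mul_left_cancel₀ hd
    linear_combination (a - b) ^ 2 * lambdaMinus a b * sq_mul_lambdaPlus hab -
      a * b * (a + b + 2 * √(a ^ 2 - a * b + b ^ 2)) * sq_mul_lambdaMinus hab -
      4 * (a * b) ^ 2 * sq_sqrt_discriminant (b := b) ha
  have hsum' := congrArg (fun x : ℝ => (x : ℂ)) hsum
  have hprod' := congrArg (fun x : ℝ => (x : ℂ)) hprod
  push_cast at hsum' hprod'
  linear_combination -hprod' + μ * hsum'

theorem quadratic_eq_zero_iff (ha : a ≠ 0) (hab : a ≠ b) (μ : ℂ) :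
    ((a : ℂ) - b) ^ 2 * μ ^ 2 + 2 * (a * b) * (a + b) * μ - 3 * (a * b) ^ 2 = 0 ↔
      μ = lambdaPlus a b ∨ μ = lambdaMinus a b := by
  have habC : ((a : ℂ) - b) ^ 2 ≠ 0 := pow_ne_zero 2 (sub_ne_zero.2 (by exact_mod_cast hab))
  rw [quadratic_eq_mul ha hab, mul_eq_zero, mul_eq_zero, sub_eq_zero, sub_eq_zero]
  simp only [habC, false_or]

theorem cayleyCoeff_two (ha : a ≠ 0) (hb : b ≠ 0) (hab : a ≠ b) :
    cayleyCoeff a b 2 = Polynomial.C (-((a : ℂ) - b) ^ 2 / (8 * (a * b) ^ 2)) *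
      ((Polynomial.X - Polynomial.C (lambdaPlus a b : ℂ)) *
        (Polynomial.X - Polynomial.C (lambdaMinus a b : ℂ))) := by
  have haC : (a : ℂ) ≠ 0 := by exact_mod_cast ha
  have hbC : (b : ℂ) ≠ 0 := by exact_mod_cast hb
  have s0 : sqrtCoeff 0 = 1 := by norm_num [sqrtCoeff]
  have s1 : sqrtCoeff 1 = 1 / 2 := by norm_num [sqrtCoeff, Nat.centralBinom, Nat.choose]
  have s2 : sqrtCoeff 2 = -1 / 8 := by norm_num [sqrtCoeff, Nat.centralBinom, Nat.choose]
  have a2 : Finset.HasAntidiagonal.antidiagonal 2 = {((0 : ℕ), (2 : ℕ)), (1, 1), (2, 0)} := rfl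
  have a1 : Finset.HasAntidiagonal.antidiagonal 1 = {((0 : ℕ), (1 : ℕ)), (1, 0)} := rfl
  have a0 : Finset.HasAntidiagonal.antidiagonal 0 = {((0 : ℕ), (0 : ℕ))} := rfl
  refine Polynomial.funext fun μ => ?_
  have hq := quadratic_eq_mul ha hab μ
  simp [cayleyCoeff, a2, a1, a0, s0, s1, s2]
  field_simp
  linear_combination (-4) * hq

theorem roots_cayleyCoeff_two (ha : a ≠ 0) (hb : b ≠ 0) (hab : a ≠ b) :
    (cayleyCoeff a b 2).roots = {(lambdaPlus a b : ℂ), (lambdaMinus a b : ℂ)} := by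
  have haC : (a : ℂ) ≠ 0 := by exact_mod_cast ha
  have hbC : (b : ℂ) ≠ 0 := by exact_mod_cast hb
  have habC : (a : ℂ) - b ≠ 0 := sub_ne_zero.2 (by exact_mod_cast hab)
  have hc : -((a : ℂ) - b) ^ 2 / (8 * (a * b) ^ 2) ≠ 0 := by
    simp [haC, hbC, habC]
  rw [cayleyCoeff_two ha hb hab, Polynomial.roots_C_mul _ hc, Polynomial.roots_mul
    (mul_ne_zero (Polynomial.X_sub_C_ne_zero _) (Polynomial.X_sub_C_ne_zero _)),
    Polynomial.roots_X_sub_C, Polynomial.roots_X_sub_C]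
  rfl

/-- The confocal conics with a circumscribed triangular orbit. -/
theorem isNCaustic_three_iff (ha : a ≠ 0) (hb : b ≠ 0) (hab : a ≠ b) (μ : ℂ) :
    (μ ≠ a ∧ μ ≠ b ∧ IsNCaustic 3 (confocal a b 0) (confocal a b μ)) ↔
      μ = lambdaPlus a b ∨ μ = lambdaMinus a b := by
  have haC : (a : ℂ) ≠ 0 := by exact_mod_cast ha
  have hbC : (b : ℂ) ≠ 0 := by exact_mod_cast hb
  rw [← quadratic_eq_zero_iff ha hab]
  constructor
  · rintro ⟨hμa, hμb, -, -, p, hp, hcirc⟩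
    have h := cayley_of_circumscribed ha hb hμa hμb hp.mem hcirc
    field_simp at h
    linear_combination h
  · intro h
    have hμa : μ ≠ a := by
      rintro rfl
      exact pow_ne_zero 4 haC (by linear_combination h)
    have hμb : μ ≠ b := by
      rintro rfl
      exact pow_ne_zero 4 hbC (by linear_combination h)
    have hμ0 : μ ≠ 0 := by
      rintro rfl
      exact pow_ne_zero 2 (mul_ne_zero haC hbC) (by linear_combination -h / 3)
    refine ⟨hμa, hμb, inGeneralPosition_confocal ha hb hab hμa hμb hμ0,
      isComplexCaustic_confocal ha hb hab hμa hμb, ?_⟩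
    -- with `k = (a - μ) / a` and `l = (b - μ) / b`, Cayley's condition is `(k - l + 1)² = 4 k`
    -- and also `(k - l - 1)² = 4 l`
    refine exists_triangular_orbit ha hb (X := ((b - μ) / b - (a - μ) / a - 1) / 2) hμa hμb ?_ ?_
    · field_simp
      linear_combination -h
    · field_simp
      linear_combination -h

theorem locus_confocal_injective {μ ν : ℂ} (hμ : μ ≠ a)
    (h : locus (confocal a b μ) = locus (confocal a b ν)) : μ = ν := by
  have hμ' : (a : ℂ) - μ ≠ 0 := sub_ne_zero.2 hμ.symm
  obtain ⟨x, hx⟩ := IsAlgClosed.exists_pow_nat_eq ((a : ℂ) - μ) two_pos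
  have h1 : affinePoint x 0 ∈ locus (confocal a b μ) := by
    rw [affinePoint_mem_confocal, hx]; simp [hμ']
  rw [h, affinePoint_mem_confocal, hx] at h1
  have hν : (a : ℂ) - ν ≠ 0 := by
    intro h0; simp [h0] at h1
  field_simp at h1
  simpa using h1

/-! ### Real parts -/

theorem realLocus_confocal (a b t : ℝ) : realLocus (confocal a b t) =
    {P | P 0 ^ 2 / (a - t) + P 1 ^ 2 / (b - t) = 1} := by
  ext P
  have : confocal a b t ![(P 0 : ℂ), (P 1 : ℂ), 1] =
      ((P 0 ^ 2 / (a - t) + P 1 ^ 2 / (b - t) - 1 : ℝ) : ℂ) := by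
    rw [confocal_eq, weightedSumSquares_eq]
    simp [confocalCoeff, dotProduct, Fin.sum_univ_three]
    ring
  change confocal a b t ![(P 0 : ℂ), (P 1 : ℂ), 1] = 0 ↔ P 0 ^ 2 / (a - t) + P 1 ^ 2 / (b - t) = 1
  rw [this, Complex.ofReal_eq_zero, sub_eq_zero]

theorem realLocus_confocal_zero (a b : ℝ) : realLocus (confocal a b 0) =
    {P | P 0 ^ 2 / a + P 1 ^ 2 / b = 1} := by
  simpa using realLocus_confocal a b 0

theorem isEllipse_of_pos {A B : ℝ} (hA : 0 < A) (hB : 0 < B) :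
    IsEllipse {P | P 0 ^ 2 / A + P 1 ^ 2 / B = 1} :=
  ⟨IsometryEquiv.refl _, A, B, hA, hB, rfl⟩

theorem isHyperbola_of_pos_neg {A B : ℝ} (hA : 0 < A) (hB : B < 0) :
    IsHyperbola {P | P 0 ^ 2 / A + P 1 ^ 2 / B = 1} := by
  refine ⟨IsometryEquiv.refl _, A, -B, hA, neg_pos.2 hB, ?_⟩
  simp only [div_neg, sub_neg_eq_add]
  rfl

theorem isHyperbola_of_neg_pos {A B : ℝ} (hA : A < 0) (hB : 0 < B) :
    IsHyperbola {P | P 0 ^ 2 / A + P 1 ^ 2 / B = 1} := by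
  refine ⟨(LinearIsometryEquiv.piLpCongrLeft 2 ℝ ℝ (Equiv.swap 0 1)).toIsometryEquiv, B, -A, hB,
    neg_pos.2 hA, ?_⟩
  ext P
  simp [LinearIsometryEquiv.piLpCongrLeft_apply, Equiv.piCongrLeft', div_neg, add_comm]

theorem ellipse_lt_one {A B A' B' x y : ℝ} (hA : 0 < A) (hAA' : A < A') (hB : 0 < B)
    (hBB' : B < B') (h : x ^ 2 / A + y ^ 2 / B = 1) : x ^ 2 / A' + y ^ 2 / B' < 1 := by
  rw [← h]
  have hx : x ^ 2 / A' ≤ x ^ 2 / A := by gcongr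
  by_cases hy0 : y = 0
  · have hx0 : x ≠ 0 := by
      rintro rfl
      simp [hy0] at h
    have : x ^ 2 / A' < x ^ 2 / A := by gcongr
    simpa [hy0] using this
  · have : y ^ 2 / B' < y ^ 2 / B := by gcongr
    linarith

theorem exists_pos_hyperbola {A B : ℝ} (hA : 0 < A) (hB : B < 0) (y : ℝ) :
    ∃ x, 0 < x ∧ x ^ 2 / A + y ^ 2 / B = 1 := by
  have h1 : y ^ 2 / B ≤ 0 := div_nonpos_of_nonneg_of_nonpos (sq_nonneg y) hB.le
  have h2 : 0 < A * (1 - y ^ 2 / B) := by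
    apply mul_pos hA; linarith
  refine ⟨√(A * (1 - y ^ 2 / B)), Real.sqrt_pos.2 h2, ?_⟩
  rw [Real.sq_sqrt h2.le, mul_div_cancel_left₀ _ hA.ne']
  ring

theorem hyperbola_sq_lt {A B A' B' x x' y : ℝ} (hA : 0 < A) (hAA' : A < A') (hB' : B' < 0)
    (hBB' : B < B') (h : x ^ 2 / A + y ^ 2 / B = 1) (h' : x' ^ 2 / A' + y ^ 2 / B' = 1) :
    x ^ 2 < x' ^ 2 := by
  have hA' : 0 < A' := hA.trans hAA'
  have hB : B < 0 := hBB'.trans hB'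
  have hy : y ^ 2 / -B ≤ y ^ 2 / -B' := by
    have : 0 < -B' := neg_pos.2 hB'
    gcongr
  have hy0 : 0 ≤ y ^ 2 / -B := by
    have : 0 < -B := neg_pos.2 hB
    positivity
  rw [div_neg, div_neg] at hy
  rw [div_neg] at hy0
  have e : x ^ 2 = A * (1 - y ^ 2 / B) := by
    rw [← h]; field_simp; ring
  have e' : x' ^ 2 = A' * (1 - y ^ 2 / B') := by
    rw [← h']; field_simp; ring
  rw [e, e']
  calc A * (1 - y ^ 2 / B) < A' * (1 - y ^ 2 / B) := by
        apply mul_lt_mul_of_pos_right hAA'; linarith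
    _ ≤ A' * (1 - y ^ 2 / B') := by
        apply mul_le_mul_of_nonneg_left _ hA'.le; linarith

/-- Each branch of a hyperbola lies between the corresponding branches of a narrower and a wider
hyperbola with the same axes. -/
theorem hyperbola_branches_between {A₁ B₁ A B A₂ B₂ : ℝ} (hA₁ : 0 < A₁) (hA : A₁ < A) (hA₂ : A < A₂)
    (hB₁ : B₁ < B) (hB : B < B₂) (hB₂ : B₂ < 0) :
    rightBranch {P | P 0 ^ 2 / A + P 1 ^ 2 / B = 1} ⊆
        between (rightBranch {P | P 0 ^ 2 / A₁ + P 1 ^ 2 / B₁ = 1})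
          (rightBranch {P | P 0 ^ 2 / A₂ + P 1 ^ 2 / B₂ = 1}) ∧
      leftBranch {P | P 0 ^ 2 / A + P 1 ^ 2 / B = 1} ⊆
        between (leftBranch {P | P 0 ^ 2 / A₂ + P 1 ^ 2 / B₂ = 1})
          (leftBranch {P | P 0 ^ 2 / A₁ + P 1 ^ 2 / B₁ = 1}) := by
  have hB0 : B < 0 := hB.trans hB₂
  have hA0 : 0 < A := hA₁.trans hA
  have key : ∀ P : Plane, P 0 ^ 2 / A + P 1 ^ 2 / B = 1 → ∃ s t : ℝ, 0 < s ∧ 0 < t ∧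
      s ^ 2 / A₁ + P 1 ^ 2 / B₁ = 1 ∧ t ^ 2 / A₂ + P 1 ^ 2 / B₂ = 1 ∧ s < |P 0| ∧ |P 0| < t := by
    intro P hP
    obtain ⟨s, hs0, hs⟩ := exists_pos_hyperbola hA₁ (hB₁.trans hB0) (P 1)
    obtain ⟨t, ht0, ht⟩ := exists_pos_hyperbola (hA0.trans hA₂) hB₂ (P 1)
    refine ⟨s, t, hs0, ht0, hs, ht, ?_, ?_⟩
    · exact lt_of_pow_lt_pow_left₀ 2 (abs_nonneg _) (by
        rw [sq_abs]; exact hyperbola_sq_lt hA₁ hA hB0 hB₁ hs hP)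
    · exact abs_lt_of_sq_lt_sq (hyperbola_sq_lt hA0 hA₂ hB₂ hB hP ht) ht0.le
  constructor
  · rintro P ⟨hP, hP0⟩
    obtain ⟨s, t, hs0, ht0, hs, ht, h1, h2⟩ := key P hP
    rw [abs_of_pos hP0] at h1 h2
    exact ⟨!₂[s, P 1], ⟨by simpa using hs, by simpa using hs0⟩, !₂[t, P 1],
      ⟨by simpa using ht, by simpa using ht0⟩, by simp, by simp, by simpa using h1,
      by simpa using h2⟩
  · rintro P ⟨hP, hP0⟩
    obtain ⟨s, t, hs0, ht0, hs, ht, h1, h2⟩ := key P hP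
    rw [abs_of_neg hP0] at h1 h2
    exact ⟨!₂[-t, P 1], ⟨by simpa using ht, by simpa using ht0⟩, !₂[-s, P 1],
      ⟨by simpa using hs, by simpa using hs0⟩, by simp, by simp,
      by simp; linarith, by simp; linarith⟩

theorem ellipse_bounds (ha : 0 < a) (hb : 0 < b) (hab : a ≠ b) :
    lambdaPlus a b < 0 ∧ 0 < lambdaMinus a b ∧ 0 < a - lambdaMinus a b ∧
      0 < b - lambdaMinus a b := by
  have h1 := lambdaPlus_mul ha.ne' hab
  have h2 := lambdaMinus_mul ha.ne' hab
  obtain ⟨-, h3⟩ := abs_lt.1 (abs_add_lt hab)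
  obtain ⟨-, h4⟩ := abs_lt.1 (abs_two_mul_sub_lt (a := a) hb.ne')
  obtain ⟨-, h5⟩ := abs_lt.1 (abs_two_mul_sub_lt' (b := b) ha.ne')
  set r := √(a ^ 2 - a * b + b ^ 2)
  have hab0 := mul_pos ha hb
  have hp : 0 < 2 * r - (a + b) := by linarith
  have hm : 0 < 2 * r + (a + b) := by linarith
  refine ⟨?_, ?_, ?_, ?_⟩
  · exact neg_of_mul_neg_left (b := 2 * r - (a + b)) (by linarith) hp.le
  · exact pos_of_mul_pos_left (b := 2 * r + (a + b)) (by linarith) hm.le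
  · refine pos_of_mul_pos_left (b := 2 * r + (a + b)) ?_ hm.le
    have := mul_pos ha (show 0 < 2 * r - (2 * b - a) by linarith)
    linarith
  · refine pos_of_mul_pos_left (b := 2 * r + (a + b)) ?_ hm.le
    have := mul_pos hb (show 0 < 2 * r - (2 * a - b) by linarith)
    linarith

theorem hyperbola_bounds (ha : 0 < a) (hb : b < 0) :
    0 < lambdaPlus a b ∧ lambdaMinus a b < 0 ∧ 0 < a - lambdaPlus a b ∧
      b - lambdaMinus a b < 0 := by
  have hab : a ≠ b := (hb.trans ha).ne'
  have h1 := lambdaPlus_mul ha.ne' hab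
  have h2 := lambdaMinus_mul ha.ne' hab
  obtain ⟨h3', h3⟩ := abs_lt.1 (abs_add_lt hab)
  obtain ⟨-, h4⟩ := abs_lt.1 (abs_two_mul_sub_lt (a := a) hb.ne)
  obtain ⟨h5, -⟩ := abs_lt.1 (abs_two_mul_sub_lt' (b := b) ha.ne')
  set r := √(a ^ 2 - a * b + b ^ 2)
  have hab0 := mul_neg_of_pos_of_neg ha hb
  have hp : 0 < 2 * r - (a + b) := by linarith
  have hm : 0 < 2 * r + (a + b) := by linarith
  refine ⟨?_, ?_, ?_, ?_⟩
  · exact pos_of_mul_pos_left (b := 2 * r - (a + b)) (by linarith) hp.le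
  · exact neg_of_mul_neg_left (b := 2 * r + (a + b)) (by linarith) hm.le
  · refine pos_of_mul_pos_left (b := 2 * r - (a + b)) ?_ hp.le
    have := mul_pos ha (show 0 < 2 * r + (2 * b - a) by linarith)
    linarith
  · refine neg_of_mul_neg_left (b := 2 * r + (a + b)) ?_ hm.le
    have := mul_neg_of_neg_of_pos hb (show 0 < 2 * r - (2 * a - b) by linarith)
    linarith

end Parameters

end ComplexBilliard

theorem proposition2p27 (a b : ℝ) (ha : a ≠ 0) (hb : b ≠ 0) (hab : a ≠ b) (hC : 0 < a ∨ 0 < b) :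
    -- the polynomial of triangular caustics has exactly two roots, which are distinct and real
    (lambdaPlus a b ≠ lambdaMinus a b ∧
      (cayleyCoeff a b 2).roots = {(lambdaPlus a b : ℂ), (lambdaMinus a b : ℂ)}) ∧
    -- the confocal 3-caustics
    {μ : ℂ | μ ≠ a ∧ μ ≠ b ∧ IsNCaustic 3 (confocal a b 0) (confocal a b μ)} =
      {(lambdaPlus a b : ℂ), (lambdaMinus a b : ℂ)} ∧
    {D : Set CP2 | ∃ μ : ℂ, μ ≠ a ∧ μ ≠ b ∧ IsNCaustic 3 (confocal a b 0) (confocal a b μ) ∧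
      D = locus (confocal a b μ)}.ncard = 2 ∧
    -- ellipses
    (0 < a → 0 < b →
      (a < a - lambdaPlus a b ∧ a - lambdaMinus a b < a ∧ 0 < a - lambdaMinus a b) ∧
      (b < b - lambdaPlus a b ∧ b - lambdaMinus a b < b ∧ 0 < b - lambdaMinus a b) ∧
      IsEllipse (realLocus (confocal a b 0)) ∧
      IsEllipse (realLocus (confocal a b (lambdaPlus a b))) ∧
      IsEllipse (realLocus (confocal a b (lambdaMinus a b))) ∧
      realLocus (confocal a b (lambdaMinus a b)) ⊆ ellipseInterior a b ∧
      realLocus (confocal a b 0) ⊆ ellipseInterior (a - lambdaPlus a b) (b - lambdaPlus a b)) ∧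
    -- hyperbolas
    (a * b < 0 →
      IsHyperbola (realLocus (confocal a b 0)) ∧
      IsHyperbola (realLocus (confocal a b (lambdaPlus a b))) ∧
      IsHyperbola (realLocus (confocal a b (lambdaMinus a b)))) ∧
    (0 < a → b < 0 →
      (a < a - lambdaMinus a b ∧ a - lambdaPlus a b < a ∧ 0 < a - lambdaPlus a b) ∧
      (b - lambdaMinus a b < 0 ∧ b < b - lambdaMinus a b ∧ b - lambdaPlus a b < b) ∧
      rightBranch (realLocus (confocal a b 0)) ⊆
        between (rightBranch (realLocus (confocal a b (lambdaPlus a b))))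
          (rightBranch (realLocus (confocal a b (lambdaMinus a b)))) ∧
      leftBranch (realLocus (confocal a b 0)) ⊆
        between (leftBranch (realLocus (confocal a b (lambdaMinus a b))))
          (leftBranch (realLocus (confocal a b (lambdaPlus a b))))) := by
  refine ⟨⟨lambdaPlus_ne_lambdaMinus ha hb hab, roots_cayleyCoeff_two ha hb hab⟩, ?_, ?_, ?_, ?_, ?_⟩
  · ext μ
    exact isNCaustic_three_iff ha hb hab μ
  · have hset : {D : Set CP2 | ∃ μ : ℂ, μ ≠ a ∧ μ ≠ b ∧
        IsNCaustic 3 (confocal a b 0) (confocal a b μ) ∧ D = locus (confocal a b μ)} =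
        {locus (confocal a b (lambdaPlus a b)), locus (confocal a b (lambdaMinus a b))} := by
      ext D
      constructor
      · rintro ⟨μ, h1, h2, h3, rfl⟩
        rcases (isNCaustic_three_iff ha hb hab μ).1 ⟨h1, h2, h3⟩ with rfl | rfl
        exacts [Or.inl rfl, Or.inr rfl]
      · rintro (rfl | rfl)
        · obtain ⟨h1, h2, h3⟩ := (isNCaustic_three_iff ha hb hab _).2 (Or.inl rfl)
          exact ⟨_, h1, h2, h3, rfl⟩
        · obtain ⟨h1, h2, h3⟩ := (isNCaustic_three_iff ha hb hab _).2 (Or.inr rfl)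
          exact ⟨_, h1, h2, h3, rfl⟩
    rw [hset, Set.ncard_pair]
    intro h
    have hne := ((isNCaustic_three_iff ha hb hab _).2 (Or.inl rfl)).1
    exact lambdaPlus_ne_lambdaMinus ha hb hab
      (Complex.ofReal_injective (locus_confocal_injective hne h))
  · intro ha0 hb0
    obtain ⟨h1, h2, h3, h4⟩ := ellipse_bounds ha0 hb0 hab
    rw [realLocus_confocal, realLocus_confocal, realLocus_confocal_zero]
    refine ⟨⟨by linarith, by linarith, h3⟩, ⟨by linarith, by linarith, h4⟩,
      isEllipse_of_pos ha0 hb0, isEllipse_of_pos (by linarith) (by linarith),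
      isEllipse_of_pos h3 h4, fun P hP => ?_, fun P hP => ?_⟩
    · exact ellipse_lt_one h3 (by linarith) h4 (by linarith) hP
    · exact ellipse_lt_one ha0 (by linarith) hb0 (by linarith) hP
  · intro hab0
    rw [realLocus_confocal, realLocus_confocal, realLocus_confocal_zero]
    rcases mul_neg_iff.1 hab0 with ⟨ha0, hb0⟩ | ⟨ha0, hb0⟩
    · obtain ⟨h1, h2, h3, h4⟩ := hyperbola_bounds ha0 hb0
      exact ⟨isHyperbola_of_pos_neg ha0 hb0, isHyperbola_of_pos_neg h3 (by linarith),
        isHyperbola_of_pos_neg (by linarith) h4⟩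
    · obtain ⟨h1, h2, h3, h4⟩ := hyperbola_bounds hb0 ha0
      rw [lambdaPlus_comm a b, lambdaMinus_comm a b]
      exact ⟨isHyperbola_of_neg_pos ha0 hb0, isHyperbola_of_neg_pos (by linarith) h3,
        isHyperbola_of_neg_pos h4 (by linarith)⟩
  · intro ha0 hb0
    obtain ⟨h1, h2, h3, h4⟩ := hyperbola_bounds ha0 hb0
    rw [realLocus_confocal, realLocus_confocal, realLocus_confocal_zero]
    exact ⟨⟨by linarith, by linarith, h3⟩, ⟨h4, by linarith, by linarith⟩,
      hyperbola_branches_between h3 (by linarith) (by linarith) (by linarith) (by linarith) h4⟩
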